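/- Let $\mathcal A$ and $\mathcal B$ be abelian categories with enough projective objects, and let $F:\mathcal A\to\mathcal B$ and $H:\mathcal B\to\mathcal A$ be faithful additive functors forming a Frobenius pair, i.e. both $(F,H)$ and $(H,F)$ are adjoint pairs. Let $\eta:\mathrm{Id}_{\mathcal A}\to HF$ and $\varepsilon:FH\to\mathrm{Id}_{\mathcal B}$ be the unit and counit of the adjoint pair $(F,H)$. An object of $\mathcal A$ is Gorenstein projective if it is isomorphic to an object of cycles of an acyclic complex of projective objects which remains acyclic under $\mathrm{Hom}_{\mathcal A}(-,Q)$ for every projective $Q$. Let $\mathcal{GP}(\mathcal A)$ be the full subcategory of these objects, and let $\mathcal{GP}^{<\infty}(\mathcal A)$ be the full subcategory of objects $X$ of finite Gorenstein projective dimension, i.e. admitting an exact sequence $0\to G_n\to\cdots\to G_0\to X\to 0$ with all $G_i$ in $\mathcal{GP}(\mathcal A)$. On $\mathcal{GP}^{<\infty}(\mathcal A)$ take the Gorenstein projective model structure: cofibrations are the monomorphisms with cokernel in $\mathcal{GP}(\mathcal A)$, fibrations are the epimorphisms of $\mathcal A$ between objects of $\mathcal{GP}^{<\infty}(\mathcal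 A)$, and weak equivalences are the composites of a monomorphism with projective cokernel followed by an epimorphism whose kernel has finite projective dimension (through an object of $\mathcal{GP}^{<\infty}(\mathcal A)$). Let $\underline{\mathcal{GP}}(\mathcal A)$ be the quotient of $\mathcal{GP}(\mathcal A)$ by the morphisms that factor through a projective object, with its usual triangulated structure: $\Sigma M$ is given by an exact sequence $0\to M\to P\to\Sigma M\to 0$ with $P$ projective and $\Sigma M$ in $\mathcal{GP}(\mathcal A)$, and the distinguished triangles are those isomorphic to $M\xrightarrow{f}N\to L\to\Sigma M$ with $L$ the pushout of $f$ and $M\to P$. Use the same notation for $\mathcal B$. The functors $F$ and $H$ restrict to the categories $\mathcal{GP}$ and $\mathcal{GP}^{<\infty}$ and induce functors between the stable categories, and the adjunction $(F,H)$ passes to these restrictions and to the stable categories. Then the following are equivalent: 1. $(F,H)$ is a Quillen equivalence between $\mathcal{GP}^{<\infty}(\mathcal A)$ and $\mathcal{GP}^{<\infty}(\mathcal B)$; that is, $F$ preserves cofibrations and trivial cofibrations, and for all cofibrant $X$ in $\mathcal{GP}^{<\infty}(\mathcal A)$ and fibrant $Y$ in $\mathcal{GP}^{<\infty}(\mathcal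 B)$, a morphism $F(X)\to Y$ is a weak equivalence if and only if its adjunct $X\to H(Y)$ is a weak equivalence. 2. For every $X\in\mathcal{GP}(\mathcal A)$ and every $Y\in\mathcal{GP}^{<\infty}(\mathcal B)$, both $\mathrm{Coker}(\eta_X)$ and $\mathrm{Ker}(\varepsilon_Y)$ have finite projective dimension. 3. $F$ and $H$ induce an adjoint pair of mutually inverse triangle equivalences $F:\underline{\mathcal{GP}}(\mathcal A)\rightleftarrows\underline{\mathcal{GP}}(\mathcal B):H$; that is, both induced functors are triangle functors, and the unit and counit of the induced adjunction are isomorphisms. -/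

import Mathlib

open CategoryTheory CategoryTheory.Limits HomotopicalAlgebra ZeroObject

universe v u v' u'

namespace GorensteinStable

/-! ### Gorenstein projective objects and dimensions -/

section Objects

variable {A : Type u} [Category.{v} A] [Abelian A]

/-- A complex is totally acyclic if it is an acyclic complex of projectives which stays acyclic
under `Hom(-, Q)` for each projective object `Q`. The last field is the exactness of
`Hom(K_i, Q) ⟶ Hom(K_{i+1}, Q) ⟶ Hom(K_{i+2}, Q)` at the middle term. -/
structure IsTotallyAcyclic (K : ChainComplex A ℤ) : Prop where
  projective : ∀ i, Projective (K.X i)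
  acyclic : K.Acyclic
  exact_hom : ∀ (Q : A), Projective Q → ∀ (i : ℤ) (f : K.X (i + 1) ⟶ Q),
    K.d (i + 1 + 1) (i + 1) ≫ f = 0 → ∃ g : K.X i ⟶ Q, K.d (i + 1) i ≫ g = f

variable (A) in
/-- Gorenstein projective objects: those isomorphic to an object of cycles of a totally acyclic
complex of projectives. -/
def gorensteinProjective : ObjectProperty A := fun M =>
  ∃ (K : ChainComplex A ℤ) (i : ℤ), IsTotallyAcyclic K ∧ Nonempty (M ≅ K.cycles i)

variable (A) in
/-- `gpdLE A n X` means that there is an exact sequence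
`0 ⟶ G_n ⟶ ⋯ ⟶ G_0 ⟶ X ⟶ 0` with all `G_i` Gorenstein projective (cut into short exact
sequences). -/
def gpdLE : ℕ → ObjectProperty A
  | 0 => gorensteinProjective A
  | n + 1 => fun X => ∃ (K G : A) (i : K ⟶ G) (p : G ⟶ X) (w : i ≫ p = 0),
      (ShortComplex.mk i p w).ShortExact ∧ gorensteinProjective A G ∧ gpdLE n K

variable (A) in
/-- Objects of finite Gorenstein projective dimension. -/
def finiteGpd : ObjectProperty A := fun X => ∃ n : ℕ, gpdLE A n X

variable (A) in
/-- Objects of finite projective dimension. -/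
def finitePd : ObjectProperty A := fun X => ∃ n : ℕ, HasProjectiveDimensionLE X n

instance : (gorensteinProjective A).IsClosedUnderIsomorphisms where
  of_iso := by
    rintro X Y e ⟨K, i, hK, ⟨e'⟩⟩
    exact ⟨K, i, hK, ⟨e.symm ≪≫ e'⟩⟩

lemma isTotallyAcyclic_of_isZero (K : ChainComplex A ℤ) (hK : ∀ i, IsZero (K.X i)) :
    IsTotallyAcyclic K where
  projective i := ⟨fun _ _ _ => ⟨0, (hK i).eq_of_src _ _⟩⟩
  acyclic i := by
    rw [HomologicalComplex.exactAt_iff]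
    exact ShortComplex.exact_of_isZero_X₂ _ (hK i)
  exact_hom _ _ i _ _ := ⟨0, (hK (i + 1)).eq_of_src _ _⟩

instance : (gorensteinProjective A).ContainsZero where
  exists_zero := by
    let K : ChainComplex A ℤ := HomologicalComplex.zero
    have hX : ∀ i, IsZero (K.X i) := fun _ => isZero_zero A
    exact ⟨K.cycles 0, IsZero.of_mono (K.iCycles 0) (hX 0),
      K, 0, isTotallyAcyclic_of_isZero K hX, ⟨Iso.refl _⟩⟩

instance : (finiteGpd A).ContainsZero where
  exists_zero := by
    obtain ⟨Z, hZ, h⟩ := (gorensteinProjective A).exists_prop_of_containsZero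
    exact ⟨Z, hZ, 0, h⟩

variable (A) in
/-- The full subcategory of Gorenstein projective objects. -/
abbrev GP := (gorensteinProjective A).FullSubcategory

variable (A) in
/-- The full subcategory of objects of finite Gorenstein projective dimension. -/
abbrev GPFin := (finiteGpd A).FullSubcategory

end Objects

/-! ### The Gorenstein projective model structure -/

section Model

variable {A : Type u} [Category.{v} A] [Abelian A]

/-- Cofibrations are the monomorphisms with Gorenstein projective cokernel. -/
instance : CategoryWithCofibrations (GPFin A) where
  cofibrations := fun _ _ f => Mono f.hom ∧ gorensteinProjective A (cokernel f.hom)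

/-- Fibrations are the epimorphisms of the ambient abelian category. -/
instance : CategoryWithFibrations (GPFin A) where
  fibrations := fun _ _ f => Epi f.hom

/-- Weak equivalences are the composites of a monomorphism with projective cokernel, followed
by an epimorphism whose kernel has finite projective dimension. -/
instance : CategoryWithWeakEquivalences (GPFin A) where
  weakEquivalences := fun X Y f => ∃ (Z : GPFin A) (i : X ⟶ Z) (p : Z ⟶ Y), i ≫ p = f ∧
    Mono i.hom ∧ Projective (cokernel i.hom) ∧ Epi p.hom ∧ finitePd A (kernel p.hom)

end Model

/-! ### Quillen adjunctions and Quillen equivalences -/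

section Quillen

variable {C : Type u} [Category.{v} C] {D : Type u'} [Category.{v'} D]
  [CategoryWithCofibrations C] [CategoryWithFibrations C] [CategoryWithWeakEquivalences C]
  [CategoryWithCofibrations D] [CategoryWithFibrations D] [CategoryWithWeakEquivalences D]
  {L : C ⥤ D} {R : D ⥤ C}

/-- An adjunction is a Quillen adjunction if its left adjoint preserves cofibrations and trivial
cofibrations. -/
structure IsQuillenAdjunction (_adj : L ⊣ R) : Prop where
  map_cofibrations : ∀ ⦃X Y : C⦄ (f : X ⟶ Y), cofibrations C f → cofibrations D (L.map f)
  map_trivialCofibrations : ∀ ⦃X Y : C⦄ (f : X ⟶ Y),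
    trivialCofibrations C f → trivialCofibrations D (L.map f)

/-- A Quillen equivalence is a Quillen adjunction such that, for `X` cofibrant and `Y` fibrant, a
map `L X ⟶ Y` is a weak equivalence if and only if its adjunct `X ⟶ R Y` is one. -/
structure IsQuillenEquivalence [HasInitial C] [HasTerminal D] (adj : L ⊣ R) : Prop extends
    IsQuillenAdjunction adj where
  weakEquivalences_iff : ∀ (X : C) (Y : D), IsCofibrant X → IsFibrant Y → ∀ f : L.obj X ⟶ Y,
    (weakEquivalences D f ↔ weakEquivalences C (adj.homEquiv X Y f))

end Quillen

/-! ### The stable category of Gorenstein projective objects -/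

section Stable

variable {A : Type u} [Category.{v} A] [Abelian A]

variable (A) in
/-- Two morphisms are identified if their difference factors through a projective object. -/
def stableRel : HomRel (GP A) := fun X Y f g =>
  ∃ (Q : A) (_ : Projective Q) (a : X.obj ⟶ Q) (b : Q ⟶ Y.obj), f.hom - g.hom = a ≫ b

lemma stableRel_add {X Y : GP A} (f₁ f₂ g₁ g₂ : X ⟶ Y) (hf : stableRel A f₁ f₂)
    (hg : stableRel A g₁ g₂) : stableRel A (f₁ + g₁) (f₂ + g₂) := by
  obtain ⟨Q, hQ, a, b, h⟩ := hf
  obtain ⟨Q', hQ', a', b', h'⟩ := hg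
  refine ⟨Q ⊞ Q', inferInstance, biprod.lift a a', biprod.desc b b', ?_⟩
  rw [biprod.lift_desc, ← h, ← h']
  change f₁.hom + g₁.hom - (f₂.hom + g₂.hom) = _
  abel

instance : Congruence (stableRel A) where
  comp_left := by
    rintro X Y Z f g g' ⟨Q, hQ, a, b, h⟩
    refine ⟨Q, hQ, f.hom ≫ a, b, ?_⟩
    rw [Category.assoc, ← h, Preadditive.comp_sub]
    rfl
  comp_right := by
    rintro X Y Z f f' g ⟨Q, hQ, a, b, h⟩
    refine ⟨Q, hQ, a, b ≫ g.hom, ?_⟩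
    rw [← Category.assoc, ← h, Preadditive.sub_comp]
    rfl
  equivalence {X Y} :=
    { refl := fun f => ⟨0, inferInstance, 0, 0, by simp⟩
      symm := by
        rintro f g ⟨Q, hQ, a, b, h⟩
        exact ⟨Q, hQ, -a, b, by rw [Preadditive.neg_comp, ← h]; abel⟩
      trans := by
        rintro f g k ⟨Q, hQ, a, b, h⟩ ⟨Q', hQ', a', b', h'⟩
        refine ⟨Q ⊞ Q', inferInstance, biprod.lift a a', biprod.desc b b', ?_⟩
        rw [biprod.lift_desc, ← h, ← h']
        abel }

variable (A) in
/-- The stable category of Gorenstein projective objects. -/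
abbrev StableGP := CategoryTheory.Quotient (stableRel A)

noncomputable instance : Preadditive (StableGP A) :=
  CategoryTheory.Quotient.preadditive (stableRel A) (fun _ _ f₁ f₂ g₁ g₂ => stableRel_add f₁ f₂ g₁ g₂)

variable (A) in
/-- The projection to the stable category. -/
abbrev toStable : GP A ⥤ StableGP A := CategoryTheory.Quotient.functor (stableRel A)

/-- A short exact sequence `0 ⟶ M ⟶ P ⟶ N ⟶ 0` with `P` projective and `N` Gorenstein
projective. The last field records that `M ⟶ P` is a left approximation by projectives (the
relative injectivity of projectives in the Frobenius category of Gorenstein projectives). -/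
structure Cosyzygy (M : A) where
  P : A
  N : A
  i : M ⟶ P
  p : P ⟶ N
  w : i ≫ p = 0
  shortExact : (ShortComplex.mk i p w).ShortExact
  projective : Projective P
  gorensteinProjective : gorensteinProjective A N
  exists_extension : ∀ (Q : A), Projective Q → ∀ f : M ⟶ Q, ∃ g : P ⟶ Q, i ≫ g = f

lemma epi_toCycles {K : ChainComplex A ℤ} (hK : K.Acyclic) (i j : ℤ) (h : j + 1 = i) :
    Epi (K.toCycles i j) :=
  Preadditive.epi_of_isZero_cokernel' _ (K.homologyIsCokernel i j (by simp [← h]))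
    (hK j).isZero_homology

lemma nonempty_cosyzygy {M : A} (hM : gorensteinProjective A M) : Nonempty (Cosyzygy M) := by
  obtain ⟨K, j, hK, ⟨e⟩⟩ := hM
  obtain ⟨j, rfl⟩ : ∃ k, k + 1 = j := ⟨j - 1, by simp⟩
  have hrel : (ComplexShape.down ℤ).prev (j + 1) = j + 1 + 1 := by simp
  have hrel' : (ComplexShape.down ℤ).prev j = j + 1 := by simp
  have hnext : (ComplexShape.down ℤ).next (j + 1) = j := by simp
  have h1 : Epi (K.toCycles (j + 1 + 1) (j + 1)) := epi_toCycles hK.acyclic _ _ rfl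
  have h2 : Epi (K.toCycles (j + 1) j) := epi_toCycles hK.acyclic _ _ rfl
  have hw : (e.hom ≫ K.iCycles (j + 1)) ≫ K.toCycles (j + 1) j = 0 := by
    rw [← cancel_mono (K.iCycles j)]
    simp
  refine ⟨{
    P := K.X (j + 1)
    N := K.cycles j
    i := e.hom ≫ K.iCycles (j + 1)
    p := K.toCycles (j + 1) j
    w := hw
    shortExact := ?_
    projective := hK.projective _
    gorensteinProjective := ⟨K, j, hK, ⟨Iso.refl _⟩⟩
    exists_extension := ?_ }⟩
  · have hmono : Mono (e.hom ≫ K.iCycles (j + 1)) := inferInstance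
    refine { exact := ?_, mono_f := hmono, epi_g := h2 }
    refine ShortComplex.exact_of_f_is_kernel _ (KernelFork.IsLimit.ofι' _ hw ?_)
    intro T k hk
    have hk' : k ≫ K.d (j + 1) j = 0 := by
      rw [← K.toCycles_i (j + 1) j, ← Category.assoc, hk, zero_comp]
    exact ⟨K.liftCycles k j hnext hk' ≫ e.inv, by simp⟩
  · intro Q hQ f
    obtain ⟨g, hg⟩ := hK.exact_hom Q hQ (j + 1) (K.toCycles (j + 1 + 1) (j + 1) ≫ e.inv ≫ f)
      (by simp)
    refine ⟨g, ?_⟩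
    rw [← K.toCycles_i (j + 1 + 1) (j + 1), Category.assoc, cancel_epi] at hg
    rw [Category.assoc, hg, e.hom_inv_id_assoc]

/-- A chosen sequence `0 ⟶ M ⟶ P ⟶ ΣM ⟶ 0` for each Gorenstein projective object. -/
noncomputable def cosyzygy (M : GP A) : Cosyzygy M.obj := (nonempty_cosyzygy M.property).some

/-- The object `ΣM`. -/
noncomputable abbrev suspensionObj (M : GP A) : GP A :=
  ⟨(cosyzygy M).N, (cosyzygy M).gorensteinProjective⟩

/-- `h : ΣM ⟶ ΣM'` is a suspension of `f : M ⟶ M'` if both fit into a morphism between the chosen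
short exact sequences. -/
def IsSuspension {M M' : GP A} (f : M ⟶ M') (h : suspensionObj M ⟶ suspensionObj M') : Prop :=
  ∃ g : (cosyzygy M).P ⟶ (cosyzygy M').P,
    (cosyzygy M).i ≫ g = f.hom ≫ (cosyzygy M').i ∧ (cosyzygy M).p ≫ h.hom = g ≫ (cosyzygy M').p

lemma Cosyzygy.exists_desc {M : A} (S : Cosyzygy M) {T : A} (k : S.P ⟶ T) (hk : S.i ≫ k = 0) :
    ∃ l : S.N ⟶ T, S.p ≫ l = k := by
  have := S.shortExact.epi_g
  exact ⟨S.shortExact.exact.desc k hk, S.shortExact.exact.g_desc k hk⟩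

lemma exists_isSuspension {M M' : GP A} (f : M ⟶ M') : ∃ h, IsSuspension f h := by
  obtain ⟨g, hg⟩ := (cosyzygy M).exists_extension _ (cosyzygy M').projective
    (f.hom ≫ (cosyzygy M').i)
  obtain ⟨h, hh⟩ := (cosyzygy M).exists_desc (g ≫ (cosyzygy M').p)
    (by rw [← Category.assoc, hg, Category.assoc, (cosyzygy M').w, comp_zero])
  exact ⟨ObjectProperty.homMk h, g, hg, hh⟩

lemma IsSuspension.stableRel {M M' : GP A} {f f' : M ⟶ M'} {h h'} (H : IsSuspension f h)
    (H' : IsSuspension f' h') (r : stableRel A f f') : stableRel A h h' := by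
  obtain ⟨g, hg, hp⟩ := H
  obtain ⟨g', hg', hp'⟩ := H'
  obtain ⟨Q, hQ, a, b, hab⟩ := r
  obtain ⟨a', ha'⟩ := (cosyzygy M).exists_extension Q hQ a
  obtain ⟨k, hk⟩ := (cosyzygy M).exists_desc (g - g' - a' ≫ b ≫ (cosyzygy M').i) (by
    rw [Preadditive.comp_sub, Preadditive.comp_sub, hg, hg', ← Preadditive.sub_comp, hab,
      ← Category.assoc _ a', ha', Category.assoc, sub_self])
  refine ⟨_, (cosyzygy M').projective, k, (cosyzygy M').p, ?_⟩
  have : Epi (cosyzygy M).p := (cosyzygy M).shortExact.epi_g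
  rw [← cancel_epi (cosyzygy M).p, ← Category.assoc, hk]
  simp only [Preadditive.comp_sub, Preadditive.sub_comp, Category.assoc, (cosyzygy M').w,
    comp_zero, sub_zero]
  exact congrArg₂ _ hp hp'

lemma isSuspension_id (M : GP A) : IsSuspension (𝟙 M) (𝟙 _) :=
  ⟨𝟙 _, by simp, by simp [suspensionObj]⟩

lemma IsSuspension.comp {M M' M'' : GP A} {f : M ⟶ M'} {f' : M' ⟶ M''} {h h'}
    (H : IsSuspension f h) (H' : IsSuspension f' h') : IsSuspension (f ≫ f') (h ≫ h') := by
  obtain ⟨g, hg, hp⟩ := H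
  obtain ⟨g', hg', hp'⟩ := H'
  refine ⟨g ≫ g', ?_, ?_⟩
  · rw [← Category.assoc, hg, Category.assoc, hg', ← Category.assoc]
    rfl
  · rw [Category.assoc, ← hp', ← Category.assoc, ← hp, Category.assoc]
    rfl

lemma toStable_map_eq {M N : GP A} {f g : M ⟶ N} (h : stableRel A f g) :
    (toStable A).map f = (toStable A).map g :=
  CategoryTheory.Quotient.sound _ h

variable (A) in
/-- The functor sending `M` to `ΣM` and `f` to the stable class of its suspensions. -/
noncomputable def suspensionAux : GP A ⥤ StableGP A where
  obj M := (toStable A).obj (suspensionObj M)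
  map f := (toStable A).map (exists_isSuspension f).choose
  map_id M := by
    rw [← (toStable A).map_id]
    exact toStable_map_eq ((exists_isSuspension (𝟙 M)).choose_spec.stableRel (isSuspension_id M)
      (Congruence.equivalence.refl _))
  map_comp f g := by
    rw [← (toStable A).map_comp]
    exact toStable_map_eq ((exists_isSuspension (f ≫ g)).choose_spec.stableRel
      ((exists_isSuspension f).choose_spec.comp (exists_isSuspension g).choose_spec)
      (Congruence.equivalence.refl _))

variable (A) in
/-- The suspension functor of the stable category. -/
noncomputable def suspension : StableGP A ⥤ StableGP A :=
  CategoryTheory.Quotient.lift (stableRel A) (suspensionAux A) (fun _ _ f g r =>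
    toStable_map_eq ((exists_isSuspension f).choose_spec.stableRel
      (exists_isSuspension g).choose_spec r))

/-- The data `M ⟶ N ⟶ L ⟶ ΣM` of Gorenstein projective objects is a standard triangle if `L` is a
pushout of `f : M ⟶ N` and `M ⟶ P`, and `h` is the induced map in the morphism of short exact
sequences from `0 ⟶ M ⟶ P ⟶ ΣM ⟶ 0` to `0 ⟶ N ⟶ L ⟶ ΣM ⟶ 0`. -/
def IsStandardTriangle {M N L : GP A} (f : M ⟶ N) (g : N ⟶ L) (h : L ⟶ suspensionObj M) : Prop :=
  ∃ p : (cosyzygy M).P ⟶ L.obj, IsPushout f.hom (cosyzygy M).i g.hom p ∧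
    g ≫ h = 0 ∧ p ≫ h.hom = (cosyzygy M).p

/-- The distinguished triangles of the stable category are those which are isomorphic to the image
of a standard triangle. -/
def IsDistinguished {X Y Z : StableGP A} (x : X ⟶ Y) (y : Y ⟶ Z) (z : Z ⟶ (suspension A).obj X) :
    Prop :=
  ∃ (M N L : GP A) (f : M ⟶ N) (g : N ⟶ L) (h : L ⟶ suspensionObj M),
    IsStandardTriangle f g h ∧
    ∃ (a : (toStable A).obj M ≅ X) (b : (toStable A).obj N ≅ Y) (c : (toStable A).obj L ≅ Z),
      (toStable A).map f ≫ b.hom = a.hom ≫ x ∧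
      (toStable A).map g ≫ c.hom = b.hom ≫ y ∧
      (toStable A).map h ≫ (show (toStable A).obj (suspensionObj M) ⟶ _ from
        (suspension A).map a.hom) = c.hom ≫ z

variable {B : Type u'} [Category.{v'} B] [Abelian B]

/-- A functor between stable categories is a triangle functor if it is additive and, for some
natural isomorphism making it commute with the suspensions, preserves distinguished triangles. -/
def IsTriangleFunctor (T : StableGP A ⥤ StableGP B) : Prop :=
  T.Additive ∧ ∃ φ : suspension A ⋙ T ≅ T ⋙ suspension B,
    ∀ ⦃X Y Z : StableGP A⦄ (x : X ⟶ Y) (y : Y ⟶ Z) (z : Z ⟶ (suspension A).obj X),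
      IsDistinguished x y z →
        IsDistinguished (T.map x) (T.map y) (T.map z ≫ φ.hom.app X)

end Stable

/-! ### Frobenius pairs and the functors they induce -/

section Frobenius

variable {A : Type u} [Category.{v} A] {B : Type u'} [Category.{v'} B]

/-- A Frobenius pair: `F` is left adjoint as well as right adjoint to `H`. -/
structure FrobeniusPair (F : A ⥤ B) (H : B ⥤ A) where
  adj : F ⊣ H
  adj' : H ⊣ F

namespace FrobeniusPair

variable {F : A ⥤ B} {H : B ⥤ A}

/-- The Frobenius pair `(H, F)`. -/
def symm (e : FrobeniusPair F H) : FrobeniusPair H F := ⟨e.adj', e.adj⟩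

variable [Abelian A] [Abelian B] [F.Additive] [H.Additive]

set_option linter.unusedSectionVars false

lemma map_projective (e : FrobeniusPair F H) {P : A} (hP : Projective P) :
    Projective (F.obj P) :=
  have := e.adj'.leftAdjoint_preservesColimits
  e.adj.map_projective P hP

lemma map_shortExact (e : FrobeniusPair F H) {K G X : A} {i : K ⟶ G} {p : G ⟶ X} (w : i ≫ p = 0)
    (h : (ShortComplex.mk i p w).ShortExact) :
    (ShortComplex.mk (F.map i) (F.map p) (by rw [← F.map_comp, w, F.map_zero])).ShortExact :=
  have := e.adj.leftAdjoint_preservesColimits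
  have := e.adj'.rightAdjoint_preservesLimits
  h.map_of_exact F

lemma map_gorensteinProjective (e : FrobeniusPair F H) {M : A} (hM : gorensteinProjective A M) :
    gorensteinProjective B (F.obj M) := by
  have := e.adj.leftAdjoint_preservesColimits
  have := e.adj'.rightAdjoint_preservesLimits
  obtain ⟨K, i, hK, ⟨f⟩⟩ := hM
  refine ⟨(F.mapHomologicalComplex _).obj K, i, ⟨fun j => e.map_projective (hK.projective j),
    fun j => ?_, fun Q hQ j f hf => ?_⟩, ⟨F.mapIso f ≪≫ ((K.sc i).mapCyclesIso F).symm⟩⟩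
  · exact (hK.acyclic j).map F
  · change F.obj (K.X (j + 1)) ⟶ Q at f
    change F.map (K.d (j + 1 + 1) (j + 1)) ≫ f = 0 at hf
    obtain ⟨g, hg⟩ := hK.exact_hom (H.obj Q) (e.symm.map_projective hQ) j
      (e.adj.homEquiv _ _ f) (by
        rw [← e.adj.homEquiv_naturality_left, hf, e.adj.homEquiv_unit, H.map_zero, comp_zero])
    refine ⟨(e.adj.homEquiv _ _).symm g, ?_⟩
    have := e.adj.homEquiv_naturality_left_symm (K.d (j + 1) j) g
    rw [hg, Equiv.symm_apply_apply] at this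
    exact this.symm

lemma map_gpdLE (e : FrobeniusPair F H) (n : ℕ) : ∀ {X : A}, gpdLE A n X →
    gpdLE B n (F.obj X) := by
  induction n with
  | zero => exact fun h => e.map_gorensteinProjective h
  | succ n ih =>
    rintro X ⟨K, G, i, p, w, hS, hG, hK⟩
    exact ⟨_, _, _, _, _, e.map_shortExact w hS, e.map_gorensteinProjective hG, ih hK⟩

lemma map_finiteGpd (e : FrobeniusPair F H) {X : A} (h : finiteGpd A X) :
    finiteGpd B (F.obj X) :=
  ⟨h.choose, e.map_gpdLE _ h.choose_spec⟩

/-- The restriction of `F` to the objects of finite Gorenstein projective dimension. -/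
def onGPFin (e : FrobeniusPair F H) : GPFin A ⥤ GPFin B :=
  (finiteGpd B).lift ((finiteGpd A).ι ⋙ F) (fun X => e.map_finiteGpd X.property)

/-- The restriction of the adjunction `F ⊣ H` to the objects of finite Gorenstein projective
dimension. -/
noncomputable def adjOnGPFin (e : FrobeniusPair F H) : e.onGPFin ⊣ e.symm.onGPFin :=
  e.adj.restrictFullyFaithful (finiteGpd A).fullyFaithfulι (finiteGpd B).fullyFaithfulι
    (Iso.refl _) (Iso.refl _)

/-- The restriction of `F` to the Gorenstein projective objects. -/
def onGP (e : FrobeniusPair F H) : GP A ⥤ GP B :=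
  (gorensteinProjective B).lift ((gorensteinProjective A).ι ⋙ F)
    (fun X => e.map_gorensteinProjective X.property)

/-- The restriction of the adjunction `F ⊣ H` to the Gorenstein projective objects. -/
noncomputable def adjOnGP (e : FrobeniusPair F H) : e.onGP ⊣ e.symm.onGP :=
  e.adj.restrictFullyFaithful (gorensteinProjective A).fullyFaithfulι
    (gorensteinProjective B).fullyFaithfulι (Iso.refl _) (Iso.refl _)

lemma map_stableRel (e : FrobeniusPair F H) {X Y : GP A} {f g : X ⟶ Y} (h : stableRel A f g) :
    stableRel B (e.onGP.map f) (e.onGP.map g) := by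
  obtain ⟨Q, hQ, a, b, h⟩ := h
  refine ⟨F.obj Q, e.map_projective hQ, F.map a, F.map b, ?_⟩
  change F.map f.hom - F.map g.hom = _
  rw [← F.map_sub, h, F.map_comp]
  rfl

/-- The functor induced by `F` on stable categories. -/
def onStable (e : FrobeniusPair F H) : StableGP A ⥤ StableGP B :=
  CategoryTheory.Quotient.lift (stableRel A) (e.onGP ⋙ toStable B)
    (fun _ _ _ _ h => toStable_map_eq (e.map_stableRel h))

/-- The adjunction induced by `F ⊣ H` on stable categories: its unit and counit are the images of
the unit `η` and the counit `ε`. -/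
noncomputable def adjOnStable (e : FrobeniusPair F H) : e.onStable ⊣ e.symm.onStable :=
  Adjunction.mkOfUnitCounit
    { unit := CategoryTheory.Quotient.natTransLift _ (Functor.whiskerRight e.adjOnGP.unit (toStable A))
      counit := CategoryTheory.Quotient.natTransLift _
        (Functor.whiskerRight e.adjOnGP.counit (toStable B))
      left_triangle := by
        apply CategoryTheory.Quotient.natTrans_ext
        ext X
        change (toStable B).map (e.onGP.map (e.adjOnGP.unit.app X)) ≫
          𝟙 ((toStable B).obj _) ≫ (toStable B).map (e.adjOnGP.counit.app (e.onGP.obj X)) = 𝟙 _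
        rw [Category.id_comp, ← Functor.map_comp]
        exact congrArg (toStable B).map (e.adjOnGP.left_triangle_components X)
      right_triangle := by
        apply CategoryTheory.Quotient.natTrans_ext
        ext Y
        change (toStable A).map (e.adjOnGP.unit.app (e.symm.onGP.obj Y)) ≫
          𝟙 ((toStable A).obj _) ≫ (toStable A).map (e.symm.onGP.map (e.adjOnGP.counit.app Y)) =
            𝟙 _
        rw [Category.id_comp, ← Functor.map_comp]
        exact congrArg (toStable A).map (e.adjOnGP.right_triangle_components Y) }

/-- The functors `F` and `H` induce an adjoint pair of mutually inverse triangle equivalences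
between the stable categories of Gorenstein projective objects. -/
structure InducesStableTriangleEquivalence (e : FrobeniusPair F H) : Prop where
  isTriangleFunctor : IsTriangleFunctor e.onStable
  isTriangleFunctor_symm : IsTriangleFunctor e.symm.onStable
  isIso_unit : IsIso e.adjOnStable.unit
  isIso_counit : IsIso e.adjOnStable.counit

end FrobeniusPair

end Frobenius

end GorensteinStable

/-! Conditions 1 and 3 are each compared with condition 2. Each functor is a left and a right
adjoint, hence exact, and it preserves projectives because its right adjoint is exact. So weak
equivalences, cofibrations, cosyzygies and the pushouts defining triangles are all preserved: the
Quillen adjunction and the two triangle functors exist for every Frobenius pair, and only the unit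
and counit matter. By faithfulness, `η` is mono and `ε` is epi.

The homological input is that `Ext` in positive degrees vanishes from a Gorenstein projective object
to one of finite projective dimension (`finitePdOrthogonal_of_gorensteinProjective`), and that an
object which has this vanishing and is itself of finite projective dimension is projective
(`projective_of_finitePd_of_orthogonal`). Consequently an epimorphism between Gorenstein projectives
is stably invertible iff its kernel has finite projective dimension, and a monomorphism iff its
cokernel does. For a monomorphism `f : M ⟶ Y` one replaces `f` by `(f, i) : M ⟶ Y ⊞ P`, where `i : M
⟶ P` starts a cosyzygy. This gives 2 ⇔ 3 on Gorenstein projectives; the counit is carried to finite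
Gorenstein projective dimension by induction (`finitePd_kernel_counit`).

For 1 ⇒ 2, the criterion is tested on the identity of `F X`, whose adjunct is `η`, and on `ε`, whose
adjunct is an identity. For 2 ⇒ 1, the adjunct of `f` is `η` followed by `H f`, and `f` is `F` of
its adjunct followed by `ε`, so closure of weak equivalences under composition suffices; full
two-out-of-three is not needed. -/

namespace GorensteinStable

/-! ### Short exact sequences of kernels and cokernels -/

section ShortExact

variable {A : Type u} [Category.{v} A] [Abelian A]

/-- The morphisms `i` and `p` form a short exact sequence. -/
def IsSES {X Y Z : A} (i : X ⟶ Y) (p : Y ⟶ Z) : Prop :=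
  ∃ w : i ≫ p = 0, (ShortComplex.mk i p w).ShortExact

lemma IsSES.mono {X Y Z : A} {i : X ⟶ Y} {p : Y ⟶ Z} (h : IsSES i p) : Mono i :=
  h.choose_spec.mono_f

lemma IsSES.epi {X Y Z : A} {i : X ⟶ Y} {p : Y ⟶ Z} (h : IsSES i p) : Epi p :=
  h.choose_spec.epi_g

lemma IsSES.zero {X Y Z : A} {i : X ⟶ Y} {p : Y ⟶ Z} (h : IsSES i p) : i ≫ p = 0 := h.choose

lemma IsSES.exists_desc {X Y Z T : A} {i : X ⟶ Y} {p : Y ⟶ Z} (h : IsSES i p) (k : Y ⟶ T)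
    (hk : i ≫ k = 0) : ∃ l : Z ⟶ T, p ≫ l = k :=
  have := h.epi
  ⟨h.choose_spec.exact.desc k hk, h.choose_spec.exact.g_desc k hk⟩

lemma IsSES.exists_lift {X Y Z T : A} {i : X ⟶ Y} {p : Y ⟶ Z} (h : IsSES i p) (k : T ⟶ Y)
    (hk : k ≫ p = 0) : ∃ l : T ⟶ X, l ≫ i = k :=
  have := h.mono
  ⟨h.choose_spec.exact.lift k hk, h.choose_spec.exact.lift_f k hk⟩

lemma isSES_kernel {X Y : A} (p : X ⟶ Y) [Epi p] : IsSES (kernel.ι p) p :=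
  ⟨kernel.condition p, { exact := ShortComplex.exact_kernel p }⟩

lemma isSES_cokernel {X Y : A} (i : X ⟶ Y) [Mono i] : IsSES i (cokernel.π i) :=
  ⟨cokernel.condition i, { exact := ShortComplex.exact_cokernel i }⟩

lemma isSES_of_lift {X Y Z : A} {i : X ⟶ Y} {p : Y ⟶ Z} [Mono i] [Epi p] (w : i ≫ p = 0)
    (h : ∀ {T : A} (k : T ⟶ Y), k ≫ p = 0 → ∃ l : T ⟶ X, l ≫ i = k) : IsSES i p :=
  ⟨w, { exact := ShortComplex.exact_of_f_is_kernel _ (KernelFork.IsLimit.ofι' _ w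
    (fun k hk => ⟨(h k hk).choose, (h k hk).choose_spec⟩)) }⟩

lemma isSES_of_desc {X Y Z : A} {i : X ⟶ Y} {p : Y ⟶ Z} [Mono i] [Epi p] (w : i ≫ p = 0)
    (h : ∀ {T : A} (k : Y ⟶ T), i ≫ k = 0 → ∃ l : Z ⟶ T, p ≫ l = k) : IsSES i p :=
  ⟨w, { exact := ShortComplex.exact_of_g_is_cokernel _ (CokernelCofork.IsColimit.ofπ' _ w
    (fun k hk => ⟨(h k hk).choose, (h k hk).choose_spec⟩)) }⟩

lemma isSES_biprod (X Y : A) : IsSES (biprod.inl : X ⟶ X ⊞ Y) biprod.snd :=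
  ⟨by simp, (ShortComplex.Splitting.ofHasBinaryBiproduct X Y).shortExact⟩

lemma isSES_biprod' (X Y : A) : IsSES (biprod.inr : Y ⟶ X ⊞ Y) biprod.fst :=
  isSES_of_lift (by simp) (fun k hk => ⟨k ≫ biprod.snd, by
    ext
    · simp [hk]
    · simp⟩)

lemma IsSES.exists_kernel_iso {X Y Z : A} {i : X ⟶ Y} {p : Y ⟶ Z} (h : IsSES i p) :
    Nonempty (kernel p ≅ X) := by
  have := h.mono
  have := h.epi
  exact ⟨(kernelIsKernel p).conePointUniqueUpToIso h.choose_spec.fIsKernel⟩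

lemma IsSES.exists_cokernel_iso {X Y Z : A} {i : X ⟶ Y} {p : Y ⟶ Z} (h : IsSES i p) :
    Nonempty (cokernel i ≅ Z) := by
  have := h.mono
  have := h.epi
  exact ⟨(cokernelIsCokernel i).coconePointUniqueUpToIso h.choose_spec.gIsCokernel⟩

lemma isZero_cokernel_of_epi {X Y : A} (f : X ⟶ Y) [Epi f] : IsZero (cokernel f) :=
  (isZero_zero A).of_iso (cokernel.ofEpi f)

lemma isZero_kernel_of_mono {X Y : A} (f : X ⟶ Y) [Mono f] : IsZero (kernel f) :=
  (isZero_zero A).of_iso (kernel.ofMono f)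

section SnakeComp

open kernelCokernelCompSequence

variable {X Y Z : A} (f : X ⟶ Y) (g : Y ⟶ Z)

/-- In this and the next two lemmas, the six-term sequence `0 → ker f → ker fg → ker g → coker f →
coker fg → coker g → 0` reduces to three consecutive terms because the neighbouring ones vanish. -/
lemma exists_isSES_kernel_comp [Epi f] :
    ∃ (i : kernel f ⟶ kernel (f ≫ g)) (p : kernel (f ≫ g) ⟶ kernel g), IsSES i p := by
  let S := snakeInput f g
  have h1 : Mono S.L₀.f := by
    have : Mono S.L₁.f := by dsimp [S, snakeInput]; infer_instance
    infer_instance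
  have h2 : Epi S.L₀.g := S.L₁'_exact.epi_f ((isZero_cokernel_of_epi f).eq_of_tgt _ _)
  exact ⟨S.L₀.f, S.L₀.g, S.L₀.zero, { exact := S.L₀_exact, mono_f := h1, epi_g := h2 }⟩

lemma exists_isSES_cokernel_of_mono_comp [Epi g] [Mono (f ≫ g)] :
    ∃ (i : kernel g ⟶ cokernel f) (p : cokernel f ⟶ cokernel (f ≫ g)), IsSES i p := by
  let S := snakeInput f g
  have h1 : Mono S.L₁'.g := S.L₁'_exact.mono_g ((isZero_kernel_of_mono (f ≫ g)).eq_of_src _ _)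
  have h2 : Epi S.L₃.f := S.L₃_exact.epi_f ((isZero_cokernel_of_epi g).eq_of_tgt _ _)
  exact ⟨S.δ, S.L₃.f, S.L₂'.zero, { exact := S.L₂'_exact, mono_f := h1, epi_g := h2 }⟩

lemma exists_isSES_kernel_of_epi_comp [Mono f] [Epi (f ≫ g)] :
    ∃ (i : kernel (f ≫ g) ⟶ kernel g) (p : kernel g ⟶ cokernel f), IsSES i p := by
  let S := snakeInput f g
  have h1 : Mono S.L₀.g := S.L₀_exact.mono_g ((isZero_kernel_of_mono f).eq_of_src _ _)
  have h2 : Epi S.L₂'.f := S.L₂'_exact.epi_f ((isZero_cokernel_of_epi (f ≫ g)).eq_of_tgt _ _)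
  exact ⟨S.L₀.g, S.δ, S.L₁'.zero, { exact := S.L₁'_exact, mono_f := h1, epi_g := h2 }⟩

end SnakeComp

/-- The kernels of a morphism of short exact sequences, all of whose components are
epimorphisms, form a short exact sequence. -/
lemma exists_isSES_kernel {X Y Z X' Y' Z' : A} {i : X ⟶ Y} {p : Y ⟶ Z} {i' : X' ⟶ Y'}
    {p' : Y' ⟶ Z'} (h : IsSES i p) (h' : IsSES i' p') (a : X ⟶ X') (b : Y ⟶ Y') (c : Z ⟶ Z')
    (hab : i ≫ b = a ≫ i') (hbc : p ≫ c = b ≫ p') [Epi a] :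
    ∃ (j : kernel a ⟶ kernel b) (q : kernel b ⟶ kernel c), IsSES j q := by
  have := h.mono
  have := h.epi
  have := h'.mono
  have := h'.epi
  let φ : ShortComplex.mk i p h.zero ⟶ ShortComplex.mk i' p' h'.zero :=
    { τ₁ := a, τ₂ := b, τ₃ := c, comm₁₂ := hab.symm, comm₂₃ := hbc.symm }
  refine ⟨kernel.map a b i i' hab.symm, kernel.map b c p p' hbc.symm, ?_⟩
  have e : Epi (kernel.map b c p p' hbc.symm) := by
    rw [epi_iff_surjective_up_to_refinements]
    intro T z
    obtain ⟨T₁, π₁, _, y, hy⟩ := surjective_up_to_refinements_of_epi p (z ≫ kernel.ι c)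
    obtain ⟨x', hx'⟩ := h'.exists_lift (y ≫ b) (by
      rw [Category.assoc, ← hbc, ← Category.assoc, ← hy]; simp)
    obtain ⟨T₂, π₂, _, x, hx⟩ := surjective_up_to_refinements_of_epi a x'
    -- The lift `y` of `z` need not be killed by `b`, but `y ≫ b` comes from `X'`, and since `a` is
    -- epi the defect can be subtracted.
    refine ⟨T₂, π₂ ≫ π₁, inferInstance, kernel.lift b (π₂ ≫ y - x ≫ i) ?_, ?_⟩
    · simp only [Preadditive.sub_comp, Category.assoc, hab, ← hx', reassoc_of% hx, sub_self]
    · rw [← cancel_mono (kernel.ι c)]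
      simp [Preadditive.sub_comp, h.zero, hy]
  have m : Mono (kernel.map a b i i' hab.symm) := by
    have : Mono (kernel.map a b i i' hab.symm ≫ kernel.ι b) := by
      simp only [kernel.lift_ι]
      infer_instance
    exact mono_of_mono _ (kernel.ι b)
  refine isSES_of_lift ?_ ?_
  · rw [← cancel_mono (kernel.ι c)]; simp [h.zero]
  · intro T k hk
    obtain ⟨x, hx⟩ := h.exists_lift (k ≫ kernel.ι b) (by
      have := hk =≫ kernel.ι c
      simpa using this)
    refine ⟨kernel.lift a x ?_, ?_⟩
    · rw [← cancel_mono i', Category.assoc, ← hab, ← Category.assoc, hx]; simp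
    · rw [← cancel_mono (kernel.ι b)]; simpa using hx

/-- The cokernels of a morphism of short exact sequences, all of whose components are
monomorphisms, form a short exact sequence. -/
lemma exists_isSES_cokernel {X Y Z X' Y' Z' : A} {i : X ⟶ Y} {p : Y ⟶ Z} {i' : X' ⟶ Y'}
    {p' : Y' ⟶ Z'} (h : IsSES i p) (h' : IsSES i' p') (a : X ⟶ X') (b : Y ⟶ Y') (c : Z ⟶ Z')
    (hab : i ≫ b = a ≫ i') (hbc : p ≫ c = b ≫ p') [Mono c] :
    ∃ (j : cokernel a ⟶ cokernel b) (q : cokernel b ⟶ cokernel c), IsSES j q := by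
  have := h.epi
  have := h'.mono
  have := h'.epi
  refine ⟨cokernel.map a b i i' hab.symm, cokernel.map b c p p' hbc.symm, ?_⟩
  have e : Epi (cokernel.map b c p p' hbc.symm) := by
    have : Epi (cokernel.π b ≫ cokernel.map b c p p' hbc.symm) := by
      simp only [cokernel.π_desc]
      infer_instance
    exact epi_of_epi (cokernel.π b) _
  have m : Mono (cokernel.map a b i i' hab.symm) := Preadditive.mono_of_cancel_zero _ (by
    intro T w hw
    obtain ⟨T₁, π₁, _, x', hx'⟩ := surjective_up_to_refinements_of_epi (cokernel.π a) w
    obtain ⟨T₂, π₂, _, y, hy⟩ := (ShortComplex.exact_cokernel b).exact_up_to_refinements (x' ≫ i')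
      (by simpa [hw] using (hx' =≫ cokernel.map a b i i' hab.symm).symm)
    dsimp at y hy
    obtain ⟨x, rfl⟩ := h.exists_lift y (by
      rw [← cancel_mono c, Category.assoc, hbc, ← reassoc_of% hy, h'.zero, comp_zero, comp_zero,
        zero_comp])
    rw [Category.assoc, hab, ← Category.assoc, ← Category.assoc, cancel_mono] at hy
    rw [← cancel_epi π₁, ← cancel_epi π₂, hx', reassoc_of% hy]
    simp)
  refine isSES_of_desc ?_ ?_
  · rw [← cancel_epi (cokernel.π a)]; simp [reassoc_of% h'.zero]
  · intro T k hk
    obtain ⟨l, hl⟩ := h'.exists_desc (cokernel.π b ≫ k) (by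
      have := cokernel.π a ≫= hk
      simpa using this)
    refine ⟨cokernel.desc c l ?_, ?_⟩
    · rw [← cancel_epi p, ← Category.assoc, hbc, Category.assoc, hl]; simp
    · rw [← cancel_epi (cokernel.π b)]; simpa using hl

end ShortExact

/-! ### Finite projective dimension and vanishing of Ext -/

section Orthogonal

open Abelian

variable {A : Type u} [Category.{v} A] [Abelian A]

lemma finitePd_of_iso {X Y : A} (e : X ≅ Y) (h : finitePd A X) : finitePd A Y := by
  obtain ⟨n, hn⟩ := h
  exact ⟨n, hasProjectiveDimensionLT_of_iso e _⟩

lemma finitePd_of_projective {X : A} (h : Projective X) : finitePd A X :=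
  ⟨0, (projective_iff_hasProjectiveDimensionLE_zero _).1 h⟩

lemma finitePd_of_isZero {X : A} (h : IsZero X) : finitePd A X :=
  finitePd_of_projective ⟨fun _ _ _ => ⟨0, h.eq_of_src _ _⟩⟩

lemma IsSES.finitePd₂ {X Y Z : A} {i : X ⟶ Y} {p : Y ⟶ Z} (h : IsSES i p)
    (h₁ : finitePd A X) (h₃ : finitePd A Z) : finitePd A Y := by
  obtain ⟨m, hm⟩ := h₁
  obtain ⟨n, hn⟩ := h₃
  exact ⟨m + n, h.choose_spec.hasProjectiveDimensionLT_X₂ _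
    (hasProjectiveDimensionLT_of_ge _ (m + 1) _ (by lia))
    (hasProjectiveDimensionLT_of_ge _ (n + 1) _ (by lia))⟩

lemma IsSES.finitePd₁ {X Y Z : A} {i : X ⟶ Y} {p : Y ⟶ Z} (h : IsSES i p)
    (h₂ : finitePd A Y) (h₃ : finitePd A Z) : finitePd A X := by
  obtain ⟨m, hm⟩ := h₂
  obtain ⟨n, hn⟩ := h₃
  exact ⟨m + n, h.choose_spec.hasProjectiveDimensionLT_X₁ _
    (hasProjectiveDimensionLT_of_ge _ (m + 1) _ (by lia))
    (hasProjectiveDimensionLT_of_ge _ (n + 1) _ (by lia))⟩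

lemma IsSES.finitePd₃ {X Y Z : A} {i : X ⟶ Y} {p : Y ⟶ Z} (h : IsSES i p)
    (h₁ : finitePd A X) (h₂ : finitePd A Y) : finitePd A Z := by
  obtain ⟨m, hm⟩ := h₁
  obtain ⟨n, hn⟩ := h₂
  exact ⟨m + n + 1, h.choose_spec.hasProjectiveDimensionLT_X₃ _
    (hasProjectiveDimensionLT_of_ge _ (m + 1) _ (by lia))
    (hasProjectiveDimensionLT_of_ge _ (n + 1) _ (by lia))⟩

lemma exists_isSES_projective [EnoughProjectives A] (X : A) :
    ∃ (K P : A) (i : K ⟶ P) (p : P ⟶ X), Projective P ∧ IsSES i p :=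
  ⟨_, _, _, Projective.π X, inferInstance, isSES_kernel _⟩

/-- Induction on the projective dimension. -/
lemma finitePd_induction [EnoughProjectives A] {motive : A → Prop}
    (projective : ∀ X, Projective X → motive X)
    (step : ∀ {K P X : A} (i : K ⟶ P) (p : P ⟶ X), IsSES i p → Projective P → finitePd A K →
      motive K → motive X) {X : A} (hX : finitePd A X) : motive X := by
  obtain ⟨n, hn⟩ := hX
  induction n generalizing X with
  | zero => exact projective X ((projective_iff_hasProjectiveDimensionLE_zero _).2 hn)
  | succ n ih =>
    obtain ⟨K, P, i, p, hP, h⟩ := exists_isSES_projective X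
    have hK : HasProjectiveDimensionLE K n :=
      (h.choose_spec.hasProjectiveDimensionLT_X₃_iff n hP).1 hn
    exact step i p h hP ⟨n, hK⟩ (ih hK)

attribute [local instance] HasExt.standard

variable (A) in
/-- The objects `M` such that `Ext^i(M, W)` vanishes for `i > 0` and `W` of finite projective
dimension. -/
def finitePdOrthogonal : ObjectProperty A := fun M =>
  ∀ (W : A), finitePd A W → ∀ (n : ℕ) (x : Ext.{max u v} M W (n + 1)), x = 0

lemma finitePdOrthogonal_of_projective {P : A} (hP : Projective P) : finitePdOrthogonal A P :=
  fun _ _ _ x => x.eq_zero_of_projective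

lemma IsSES.finitePdOrthogonal₂ {X Y Z : A} {i : X ⟶ Y} {p : Y ⟶ Z} (h : IsSES i p)
    (h₁ : finitePdOrthogonal A X) (h₃ : finitePdOrthogonal A Z) : finitePdOrthogonal A Y := by
  intro W hW n x
  obtain ⟨y, rfl⟩ := Ext.contravariant_sequence_exact₂ h.choose_spec W x (h₁ W hW n _)
  rw [h₃ W hW n y, Ext.comp_zero]

/-- `Ext^(n+1)(X, W)` lies between `Ext^(n+1)(Y, W)` and `Ext^(n+2)(Z, W)`; this is where vanishing
in all positive degrees, not only in degree one, is used. -/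
lemma IsSES.finitePdOrthogonal₁ {X Y Z : A} {i : X ⟶ Y} {p : Y ⟶ Z} (h : IsSES i p)
    (h₂ : finitePdOrthogonal A Y) (h₃ : finitePdOrthogonal A Z) : finitePdOrthogonal A X := by
  intro W hW n x
  obtain ⟨y, rfl⟩ := Ext.contravariant_sequence_exact₁ h.choose_spec W x (add_comm 1 (n + 1))
    (h₃ W hW (n + 1) _)
  rw [h₂ W hW n y, Ext.comp_zero]

/-- The obstruction to lifting lies in `Ext^1(M, X)`; dually, in the next lemma, the obstruction to
extending lies in `Ext^1(Z, W)`. -/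
lemma IsSES.exists_lift_of_orthogonal {X Y Z M : A} {i : X ⟶ Y} {p : Y ⟶ Z} (h : IsSES i p)
    (hX : finitePd A X) (hM : finitePdOrthogonal A M) (f : M ⟶ Z) : ∃ g : M ⟶ Y, g ≫ p = f := by
  obtain ⟨y, hy⟩ := Ext.covariant_sequence_exact₃ M h.choose_spec (Ext.mk₀ f) (zero_add 1)
    (hM X hX 0 _)
  obtain ⟨g, rfl⟩ := Ext.homEquiv₀.symm.surjective y
  exact ⟨g, Ext.homEquiv₀.symm.injective (by simpa using hy)⟩

lemma IsSES.exists_extension_of_orthogonal {X Y Z W : A} {i : X ⟶ Y} {p : Y ⟶ Z}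
    (h : IsSES i p) (hZ : finitePdOrthogonal A Z) (hW : finitePd A W) (f : X ⟶ W) :
    ∃ g : Y ⟶ W, i ≫ g = f := by
  obtain ⟨y, hy⟩ := Ext.contravariant_sequence_exact₁ h.choose_spec W (Ext.mk₀ f) (add_zero 1)
    (hZ W hW 0 _)
  obtain ⟨g, rfl⟩ := Ext.homEquiv₀.symm.surjective y
  exact ⟨g, Ext.homEquiv₀.symm.injective (by simpa using hy)⟩

/-- The kernel of a projective cover map `P ⟶ M` again has finite projective dimension, so `𝟙 M`
lifts to `P` and `M` is a retract of `P`. -/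
lemma projective_of_finitePd_of_orthogonal [EnoughProjectives A] {M : A} (h : finitePd A M)
    (hM : finitePdOrthogonal A M) : Projective M := by
  obtain ⟨K, P, i, p, hP, hs⟩ := exists_isSES_projective M
  obtain ⟨s, hs'⟩ := hs.exists_lift_of_orthogonal (hs.finitePd₁ (finitePd_of_projective hP) h) hM
    (𝟙 M)
  exact (⟨s, p, hs'⟩ : Retract M P).projective

/-- Counterpart of `nonempty_cosyzygy`, one degree up in the totally acyclic complex. The extension
property is the exactness of `Hom(K, Q)`. -/
lemma exists_syzygy {M : A} (hM : gorensteinProjective A M) :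
    ∃ (M' P : A) (i : M' ⟶ P) (p : P ⟶ M), gorensteinProjective A M' ∧ Projective P ∧
      IsSES i p ∧ ∀ (Q : A), Projective Q → ∀ f : M' ⟶ Q, ∃ g : P ⟶ Q, i ≫ g = f := by
  obtain ⟨K, j, hK, ⟨e⟩⟩ := hM
  have hnext : (ComplexShape.down ℤ).next (j + 1) = j := by simp
  have h1 : Epi (K.toCycles (j + 1 + 1) (j + 1)) := epi_toCycles hK.acyclic _ _ rfl
  have h2 : Epi (K.toCycles (j + 1) j) := epi_toCycles hK.acyclic _ _ rfl
  have hw : K.iCycles (j + 1) ≫ K.toCycles (j + 1) j = 0 := by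
    rw [← cancel_mono (K.iCycles j)]
    simp
  refine ⟨K.cycles (j + 1), K.X (j + 1), K.iCycles (j + 1), K.toCycles (j + 1) j ≫ e.inv,
    ⟨K, j + 1, hK, ⟨Iso.refl _⟩⟩, hK.projective _, isSES_of_lift (by simp [reassoc_of% hw]) ?_, ?_⟩
  · intro T k hk
    have hk' : k ≫ K.d (j + 1) j = 0 := by
      rw [← K.toCycles_i (j + 1) j, ← Category.assoc,
        show k ≫ K.toCycles (j + 1) j = 0 by simpa [← Category.assoc] using hk =≫ e.hom, zero_comp]
    exact ⟨K.liftCycles k j hnext hk', by simp⟩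
  · intro Q hQ f
    obtain ⟨g, hg⟩ := hK.exact_hom Q hQ (j + 1) (K.toCycles (j + 1 + 1) (j + 1) ≫ f) (by simp)
    refine ⟨g, ?_⟩
    rwa [← K.toCycles_i (j + 1 + 1) (j + 1), Category.assoc, cancel_epi] at hg

/-- A class in `Ext^1(M, Q)` comes from a map `M' ⟶ Q` on the syzygy; this map extends to `P`, so
the class is zero. Higher degrees shift down to `M'`. -/
lemma ext_eq_zero_of_gorensteinProjective {Q : A} (hQ : Projective Q) (n : ℕ) : ∀ {M : A},
    gorensteinProjective A M → ∀ x : Ext.{max u v} M Q (n + 1), x = 0 := by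
  induction n with
  | zero =>
    intro M hM x
    obtain ⟨M', P, i, p, hM', hP, h, he⟩ := exists_syzygy hM
    obtain ⟨y, rfl⟩ := Ext.contravariant_sequence_exact₃ h.choose_spec Q x
      (Ext.eq_zero_of_projective _) (add_zero 1)
    obtain ⟨f, rfl⟩ := Ext.homEquiv₀.symm.surjective y
    obtain ⟨g, rfl⟩ := he Q hQ f
    rw [Ext.homEquiv₀_symm_apply, ← Ext.mk₀_comp_mk₀]
    exact h.choose_spec.extClass_comp_assoc _
  | succ n ih =>
    intro M hM x
    obtain ⟨M', P, i, p, hM', hP, h, -⟩ := exists_syzygy hM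
    obtain ⟨y, rfl⟩ := Ext.contravariant_sequence_exact₃ h.choose_spec Q x
      (Ext.eq_zero_of_projective _) (add_comm 1 (n + 1))
    rw [ih hM' y, Ext.comp_zero]

/-- Induction on `W`: for `0 → K → P → X → 0`, the group `Ext^(n+1)(M, X)` lies between
`Ext^(n+1)(M, P)` and `Ext^(n+2)(M, K)`. -/
lemma finitePdOrthogonal_of_gorensteinProjective [EnoughProjectives A] {M : A}
    (hM : gorensteinProjective A M) : finitePdOrthogonal A M := by
  intro W hW
  refine finitePd_induction (motive := fun W => ∀ (n : ℕ) (x : Ext.{max u v} M W (n + 1)), x = 0)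
    (fun Q hQ n x => ext_eq_zero_of_gorensteinProjective hQ n hM x) ?_ hW
  intro K P X i p h hP _ ih n x
  obtain ⟨y, rfl⟩ := Ext.covariant_sequence_exact₃ M h.choose_spec x rfl (ih (n + 1) _)
  rw [ext_eq_zero_of_gorensteinProjective hP n hM y, Ext.zero_comp]

end Orthogonal

/-! ### Constructing Gorenstein projectives; extensions -/

section Closure

variable {A : Type u} [Category.{v} A] [Abelian A]

/-- `M` is a syzygy of `N`. -/
def IsSyzygy (M N : A) : Prop :=
  ∃ (P : A) (i : M ⟶ P) (p : P ⟶ N), Projective P ∧ IsSES i p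

/-- The short exact sequences splice to an acyclic complex of projectives; orthogonality of the `m
j` to projectives gives total acyclicity. -/
lemma gorensteinProjective_of_sequence (m : ℤ → A) (h : ∀ j, IsSyzygy (m (j + 1)) (m j))
    (orth : ∀ j, finitePdOrthogonal A (m j)) (j : ℤ) : gorensteinProjective A (m j) := by
  choose P i p hP hs using h
  have hmono := fun j => (hs j).mono
  have hepi := fun j => (hs j).epi
  let K : ChainComplex A ℤ := ChainComplex.of P (fun n => p (n + 1) ≫ i n) (fun n => by
    simp only [Category.assoc, reassoc_of% (hs (n + 1)).zero, zero_comp, comp_zero])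
  have hd : ∀ n, K.d (n + 1) n = p (n + 1) ≫ i n := ChainComplex.of_d P (fun n => p (n + 1) ≫ i n)
  have hlift : ∀ (n : ℤ) {T : A} (k : T ⟶ P (n + 1)), k ≫ p (n + 1) ≫ i n = 0 →
      ∃ l : T ⟶ m (n + 1 + 1), l ≫ i (n + 1) = k := fun n T k hk =>
    (hs (n + 1)).exists_lift k (by rw [← cancel_mono (i n), Category.assoc, hk, zero_comp])
  have hK : IsTotallyAcyclic K := by
    refine ⟨hP, fun n => ?_, fun Q hQ n f hf => ?_⟩
    · obtain ⟨n, rfl⟩ : ∃ k, k + 1 = n := ⟨n - 1, by simp⟩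
      rw [K.exactAt_iff' (n + 1 + 1) (n + 1) n (by simp) (by simp),
        ShortComplex.exact_iff_exact_up_to_refinements]
      intro T k hk
      change T ⟶ P (n + 1) at k
      change k ≫ K.d (n + 1) n = 0 at hk
      rw [hd] at hk
      obtain ⟨l, hl⟩ := hlift n k hk
      obtain ⟨T', π, hπ, x, hx⟩ := surjective_up_to_refinements_of_epi (p (n + 1 + 1)) l
      refine ⟨T', π, hπ, x, ?_⟩
      change π ≫ k = x ≫ K.d (n + 1 + 1) (n + 1)
      rw [hd, ← hl, reassoc_of% hx]
    · change P (n + 1) ⟶ Q at f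
      change K.d (n + 1 + 1) (n + 1) ≫ f = 0 at hf
      rw [hd, Category.assoc, ← comp_zero (f := p (n + 1 + 1)), cancel_epi] at hf
      -- A cocycle `f` on `P (n + 1)` is a map on `m (n + 1)`, which extends along `i n` since
      -- `Ext^1(m n, Q) = 0`.
      obtain ⟨l, hl⟩ := (hs (n + 1)).exists_desc f hf
      obtain ⟨g, hg⟩ := (hs n).exists_extension_of_orthogonal (orth n)
        (finitePd_of_projective hQ) l
      refine ⟨g, ?_⟩
      rw [hd]
      change (p (n + 1) ≫ i n) ≫ g = f
      rw [Category.assoc, hg, hl]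
  -- The cycles in degree `j` are `m (j + 1)`, one index higher; the second shift puts the outgoing
  -- differential in the form `j + 1 → j`.
  obtain ⟨j, rfl⟩ : ∃ k, k + 1 + 1 = j := ⟨j - 2, by lia⟩
  have hw : i (j + 1) ≫ K.d (j + 1) j = 0 := by
    rw [hd]
    exact ((hs (j + 1)).zero =≫ i j).trans zero_comp |>.symm ▸ (by
      rw [← Category.assoc])
  refine ⟨K, j + 1, hK, ⟨IsLimit.conePointUniqueUpToIso
    (KernelFork.IsLimit.ofι' (i (j + 1)) hw (fun {T} k hk => ?_))
    (K.cyclesIsKernel (j + 1) j (by simp))⟩⟩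
  change T ⟶ P (j + 1) at k
  rw [hd] at hk
  exact ⟨(hlift j k hk).choose, (hlift j k hk).choose_spec⟩

lemma exists_sequence {α : Type*} (S : α → Prop) (r : α → α → Prop)
    (h : ∀ a, S a → ∃ b, S b ∧ r a b) (a : α) (ha : S a) :
    ∃ f : ℕ → α, f 0 = a ∧ (∀ n, S (f n)) ∧ ∀ n, r (f n) (f (n + 1)) := by
  choose b hb hr using h
  let g : ℕ → {a // S a} := fun n => Nat.rec ⟨a, ha⟩ (fun _ x => ⟨b x.1 x.2, hb x.1 x.2⟩) n
  exact ⟨fun n => (g n).1, rfl, fun n => (g n).2, fun n => hr (g n).1 (g n).2⟩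

/-- A class of objects orthogonal to the objects of finite projective dimension and admitting
cosyzygies in the class consists of Gorenstein projective objects. -/
lemma gorensteinProjective_of_class [EnoughProjectives A] (S : ObjectProperty A)
    (orth : ∀ M, S M → finitePdOrthogonal A M) (h : ∀ M, S M → ∃ N, S N ∧ IsSyzygy M N)
    {M : A} (hM : S M) : gorensteinProjective A M := by
  obtain ⟨f, hf0, hf, hf'⟩ := exists_sequence S IsSyzygy h M hM
  -- Syzygies are taken among all orthogonal objects, a class closed under them, so `S` only has to
  -- provide cosyzygies.
  obtain ⟨g, hg0, hg, hg'⟩ := exists_sequence (finitePdOrthogonal A) (fun X Y => IsSyzygy Y X)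
    (fun X hX => by
      obtain ⟨K, P, i, p, hP, hs⟩ := exists_isSES_projective X
      exact ⟨K, hs.finitePdOrthogonal₁ (finitePdOrthogonal_of_projective hP) hX, P, i, p, hP, hs⟩)
    M (orth M hM)
  -- `M = f 0 = g 0` must occur only once: index `-(n + 1)` carries `f (n + 1)`, and the passage
  -- from `-1` to `0` is a separate case below.
  let m : ℤ → A
    | Int.ofNat n => g n
    | Int.negSucc n => f (n + 1)
  have hm : m 0 = M := hg0
  rw [← hm]
  refine gorensteinProjective_of_sequence m ?_ ?_ 0
  · rintro (n | (_ | n))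
    · exact hg' n
    · have := hf' 0
      rw [hf0, ← hg0] at this
      exact this
    · exact hf' (n + 1)
  · rintro (n | n)
    · exact hg n
    · exact orth _ (hf _)

lemma Cosyzygy.isSES {M : A} (S : Cosyzygy M) : IsSES S.i S.p := ⟨S.w, S.shortExact⟩

/-- Horseshoe argument: `Y` embeds in the sum of the projectives of two cosyzygies, and the cokernel
is again an extension of Gorenstein projectives. The class of such extensions therefore satisfies
`gorensteinProjective_of_class`. -/
lemma gorensteinProjective_of_isSES [EnoughProjectives A] {X Y Z : A} {i : X ⟶ Y} {p : Y ⟶ Z}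
    (h : IsSES i p) (hX : gorensteinProjective A X) (hZ : gorensteinProjective A Z) :
    gorensteinProjective A Y := by
  refine gorensteinProjective_of_class (fun Y => ∃ (X Z : A) (i : X ⟶ Y) (p : Y ⟶ Z),
    IsSES i p ∧ gorensteinProjective A X ∧ gorensteinProjective A Z) ?_ ?_ ⟨X, Z, i, p, h, hX, hZ⟩
  · rintro Y ⟨X, Z, i, p, h, hX, hZ⟩
    exact h.finitePdOrthogonal₂ (finitePdOrthogonal_of_gorensteinProjective hX)
      (finitePdOrthogonal_of_gorensteinProjective hZ)
  · rintro Y ⟨X, Z, i, p, h, hX, hZ⟩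
    obtain ⟨S⟩ := nonempty_cosyzygy hX
    obtain ⟨T⟩ := nonempty_cosyzygy hZ
    have := h.mono
    have := h.epi
    have := S.isSES.mono
    have := T.isSES.mono
    have := S.isSES.epi
    have := T.isSES.epi
    obtain ⟨a, ha⟩ := h.exists_extension_of_orthogonal
      (finitePdOrthogonal_of_gorensteinProjective hZ) (finitePd_of_projective S.projective) S.i
    let j : Y ⟶ S.P ⊞ T.P := biprod.lift a (p ≫ T.i)
    have hj₁ : i ≫ j = S.i ≫ biprod.inl := by
      ext
      · simp [j, ha]
      · simp [j, reassoc_of% h.zero]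
    have hj₂ : j ≫ biprod.snd = p ≫ T.i := by simp [j]
    obtain ⟨u, v, huv⟩ := exists_isSES_cokernel h (isSES_biprod S.P T.P) S.i j T.i hj₁ hj₂.symm
    have hj : Mono j := Preadditive.mono_of_cancel_zero _ (fun k hk => by
      obtain ⟨l, rfl⟩ := h.exists_lift k (by
        rw [← cancel_mono T.i, Category.assoc, ← hj₂, reassoc_of% hk, zero_comp, zero_comp])
      rw [Category.assoc, hj₁, ← Category.assoc] at hk
      rw [zero_of_comp_mono S.i (zero_of_comp_mono _ hk), zero_comp])
    obtain ⟨eS⟩ := S.isSES.exists_cokernel_iso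
    obtain ⟨eT⟩ := T.isSES.exists_cokernel_iso
    have := S.projective
    have := T.projective
    exact ⟨cokernel j, ⟨_, _, u, v, huv,
      (gorensteinProjective A).prop_of_iso eS.symm S.gorensteinProjective,
      (gorensteinProjective A).prop_of_iso eT.symm T.gorensteinProjective⟩,
      _, j, _, inferInstance, isSES_cokernel j⟩

lemma gorensteinProjective_of_projective [EnoughProjectives A] {P : A} (hP : Projective P) :
    gorensteinProjective A P :=
  gorensteinProjective_of_class Projective (fun _ h => finitePdOrthogonal_of_projective h)
    (fun M h => ⟨0, inferInstance, M, 𝟙 M, 0, h, isSES_of_lift (by simp)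
      (fun k _ => ⟨k, by simp⟩)⟩) hP

/-- Adding `P` to `G_0` leaves the kernel unchanged, so no induction is needed. It keeps the middle
objects of factorizations inside `GPFin A`. -/
lemma gpdLE_biprod [EnoughProjectives A] (n : ℕ) {X P : A} (hP : Projective P)
    (h : gpdLE A n X) : gpdLE A n (X ⊞ P) := by
  cases n with
  | zero =>
    exact gorensteinProjective_of_isSES (isSES_biprod X P) h (gorensteinProjective_of_projective hP)
  | succ n =>
    obtain ⟨K, G, i, p, w, hs, hG, hK⟩ := h
    have := hs.mono_f
    have := hs.epi_g
    have : Mono (i ≫ (biprod.inl : G ⟶ G ⊞ P)) := inferInstance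
    have : Epi (biprod.map p (𝟙 P)) := inferInstance
    have hs' : IsSES (i ≫ (biprod.inl : G ⟶ G ⊞ P)) (biprod.map p (𝟙 P)) :=
      isSES_of_lift (by simp [reassoc_of% w]) (fun k hk => by
        obtain ⟨l, hl⟩ := IsSES.exists_lift ⟨w, hs⟩ (k ≫ biprod.fst)
          (by simpa using hk =≫ biprod.fst)
        refine ⟨l, ?_⟩
        ext
        · simpa using hl
        · simpa using (hk =≫ biprod.snd).symm)
    exact ⟨K, G ⊞ P, _, _, hs'.zero, hs'.choose_spec, gorensteinProjective_of_isSES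
      (isSES_biprod G P) hG (gorensteinProjective_of_projective hP), hK⟩

lemma finiteGpd_biprod [EnoughProjectives A] {X P : A} (hP : Projective P)
    (h : finiteGpd A X) : finiteGpd A (X ⊞ P) :=
  ⟨_, gpdLE_biprod _ hP h.choose_spec⟩

end Closure

/-! ### Stable isomorphisms among monomorphisms and epimorphisms -/

section StableIso

variable {A : Type u} [Category.{v} A]

/-- The morphism `f` factors through a projective object. -/
def FactorsThroughProjective {X Y : A} (f : X ⟶ Y) : Prop :=
  ∃ (Q : A) (_ : Projective Q) (a : X ⟶ Q) (b : Q ⟶ Y), f = a ≫ b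

namespace FactorsThroughProjective

lemma precomp {X Y Z : A} (f : X ⟶ Y) {g : Y ⟶ Z} (h : FactorsThroughProjective g) :
    FactorsThroughProjective (f ≫ g) := by
  obtain ⟨Q, hQ, a, b, rfl⟩ := h
  exact ⟨Q, hQ, f ≫ a, b, by simp⟩

lemma postcomp {X Y Z : A} {f : X ⟶ Y} (h : FactorsThroughProjective f) (g : Y ⟶ Z) :
    FactorsThroughProjective (f ≫ g) := by
  obtain ⟨Q, hQ, a, b, rfl⟩ := h
  exact ⟨Q, hQ, a, b ≫ g, by simp⟩

lemma projective {X : A} (h : FactorsThroughProjective (𝟙 X)) : Projective X := by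
  obtain ⟨Q, hQ, a, b, hab⟩ := h
  exact (⟨a, b, hab.symm⟩ : Retract X Q).projective

lemma of_projective {X Y : A} (hX : Projective X) (f : X ⟶ Y) : FactorsThroughProjective f :=
  ⟨X, hX, 𝟙 X, f, by simp⟩

lemma exists_factor_epi {X Y Z : A} {f : X ⟶ Z}
    (h : FactorsThroughProjective f) (p : Y ⟶ Z) [Epi p] : ∃ g : X ⟶ Y, g ≫ p = f := by
  obtain ⟨Q, hQ, a, b, rfl⟩ := h
  exact ⟨a ≫ Projective.factorThru b p, by simp⟩

variable [Abelian A]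

lemma sub {X Y : A} {f g : X ⟶ Y} (hf : FactorsThroughProjective f)
    (hg : FactorsThroughProjective g) : FactorsThroughProjective (f - g) := by
  obtain ⟨Q, hQ, a, b, rfl⟩ := hf
  obtain ⟨Q', hQ', a', b', rfl⟩ := hg
  exact ⟨Q ⊞ Q', inferInstance, biprod.lift a (-a'), biprod.desc b b', by simp [sub_eq_add_neg]⟩

end FactorsThroughProjective

variable [Abelian A]

/-- The morphism `f` is invertible modulo the morphisms which factor through a projective
object. -/
def IsStableIso {X Y : A} (f : X ⟶ Y) : Prop :=
  ∃ g : Y ⟶ X, FactorsThroughProjective (𝟙 X - f ≫ g) ∧ FactorsThroughProjective (𝟙 Y - g ≫ f)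

lemma isIso_toStable_map_iff {X Y : GP A} (f : X ⟶ Y) :
    IsIso ((toStable A).map f) ↔ IsStableIso f.hom := by
  constructor
  · rintro ⟨g, hg₁, hg₂⟩
    obtain ⟨g, rfl⟩ := (toStable A).map_surjective g
    rw [← Functor.map_comp, ← (toStable A).map_id, Quotient.functor_map_eq_iff] at hg₁ hg₂
    refine ⟨g.hom, ?_, ?_⟩
    · exact (Congruence.equivalence.symm hg₁ : stableRel A _ _)
    · exact (Congruence.equivalence.symm hg₂ : stableRel A _ _)
  · rintro ⟨g, hg₁, hg₂⟩
    refine ⟨(toStable A).map (ObjectProperty.homMk g), ?_, ?_⟩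
    · rw [← Functor.map_comp, ← (toStable A).map_id]
      exact (toStable_map_eq hg₁).symm
    · rw [← Functor.map_comp, ← (toStable A).map_id]
      exact (toStable_map_eq hg₂).symm

variable [EnoughProjectives A]

omit [EnoughProjectives A] in
/-- A stably invertible epimorphism has a projective kernel. -/
lemma IsStableIso.projective_kernel {X Y : A} {f : X ⟶ Y} [Epi f] (h : IsStableIso f) :
    Projective (kernel f) := by
  obtain ⟨g, h₁, h₂⟩ := h
  -- As `f` is epi, the error `𝟙 Y - g ≫ f` lifts along `f`, and `g + t` is a genuine section of
  -- `f`.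
  obtain ⟨t, ht⟩ := h₂.exists_factor_epi f
  obtain ⟨r, hr⟩ := (isSES_kernel f).exists_lift (𝟙 X - f ≫ (g + t)) (by simp [ht])
  have hr' : kernel.ι f ≫ r = 𝟙 _ := by
    rw [← cancel_mono (kernel.ι f), Category.assoc, hr]
    simp
  refine FactorsThroughProjective.projective ?_
  rw [← hr', ← Category.id_comp r, ← Category.assoc]
  refine FactorsThroughProjective.postcomp ?_ r
  -- Since `kernel.ι f ≫ f = 0`, this composite is `kernel.ι f` itself, which thus factors through a
  -- projective.
  have := h₁.precomp (kernel.ι f)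
  simpa using this

/-- The kernel is orthogonal and of finite projective dimension, hence projective; `f` has a section
`s`, and `𝟙 X - f ≫ s` factors through the kernel. -/
lemma isStableIso_of_finitePd_kernel {X Y : A} (hX : gorensteinProjective A X)
    (hY : gorensteinProjective A Y) (f : X ⟶ Y) [Epi f] (h : finitePd A (kernel f)) :
    IsStableIso f := by
  obtain ⟨s, hs⟩ := (isSES_kernel f).exists_lift_of_orthogonal h
    (finitePdOrthogonal_of_gorensteinProjective hY) (𝟙 Y)
  have hK : Projective (kernel f) := projective_of_finitePd_of_orthogonal h
    ((isSES_kernel f).finitePdOrthogonal₁ (finitePdOrthogonal_of_gorensteinProjective hX)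
      (finitePdOrthogonal_of_gorensteinProjective hY))
  refine ⟨s, ?_, 0, inferInstance, 0, 0, by simp [hs]⟩
  obtain ⟨r, hr⟩ := (isSES_kernel f).exists_lift (𝟙 X - f ≫ s) (by simp [hs])
  exact ⟨_, hK, r, _, hr.symm⟩

section Mono

variable {M Y : A} (S : Cosyzygy M) (f : M ⟶ Y) [Mono f]

omit [EnoughProjectives A] in
instance mono_biprod_lift {P : A} (i : M ⟶ P) : Mono (biprod.lift f i) :=
  mono_of_mono_fac (biprod.lift_fst f i)

omit [EnoughProjectives A] in
lemma isSES_zero_id (X : A) : IsSES (0 : (0 : A) ⟶ X) (𝟙 X) :=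
  isSES_of_lift (by simp) (fun k hk => ⟨0, by simpa using hk.symm⟩)

omit [EnoughProjectives A] in
-- Projecting `Y ⊞ P` to `Y` gives `0 → P → coker (f, i) → coker f → 0`.
lemma Cosyzygy.finitePd_cokernel_lift_iff :
    finitePd A (cokernel (biprod.lift f S.i)) ↔ finitePd A (cokernel f) := by
  obtain ⟨a, b, hab⟩ := exists_isSES_cokernel (isSES_zero_id M) (isSES_biprod' Y S.P)
    (0 : (0 : A) ⟶ S.P) (biprod.lift f S.i) f (by simp) (by simp)
  have : finitePd A (cokernel (0 : (0 : A) ⟶ S.P)) :=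
    finitePd_of_iso cokernelZeroIsoTarget.symm (finitePd_of_projective S.projective)
  exact ⟨hab.finitePd₃ this, hab.finitePd₂ this⟩

omit [Mono f] in
-- Projecting to `P` instead gives `0 → Y → coker (f, i) → coker i → 0`, whose outer terms are
-- Gorenstein projective.
lemma Cosyzygy.finitePdOrthogonal_cokernel_lift (hY : GorensteinStable.gorensteinProjective A Y) :
    finitePdOrthogonal A (cokernel (biprod.lift f S.i)) := by
  have := S.isSES.mono
  obtain ⟨a, b, hab⟩ := exists_isSES_cokernel (isSES_zero_id M) (isSES_biprod Y S.P)
    (0 : (0 : A) ⟶ Y) (biprod.lift f S.i) S.i (by simp) (by simp)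
  obtain ⟨e⟩ := S.isSES.exists_cokernel_iso
  exact hab.finitePdOrthogonal₂
    (finitePdOrthogonal_of_gorensteinProjective
      ((GorensteinStable.gorensteinProjective A).prop_of_iso cokernelZeroIsoTarget.symm hY))
    (finitePdOrthogonal_of_gorensteinProjective
      ((GorensteinStable.gorensteinProjective A).prop_of_iso e.symm S.gorensteinProjective))

lemma Cosyzygy.projective_cokernel_lift (hY : GorensteinStable.gorensteinProjective A Y)
    (h : finitePd A (cokernel f)) : Projective (cokernel (biprod.lift f S.i)) :=
  projective_of_finitePd_of_orthogonal ((S.finitePd_cokernel_lift_iff f).2 h)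
    (S.finitePdOrthogonal_cokernel_lift f hY)

/-- With `L = coker (f, i)` projective, `0 → M → Y ⊞ P → L → 0` splits, and the retraction
restricted to `Y` is a stable inverse of `f`. -/
lemma isStableIso_of_finitePd_cokernel (hM : gorensteinProjective A M)
    (hY : gorensteinProjective A Y) (h : finitePd A (cokernel f)) : IsStableIso f := by
  obtain ⟨S⟩ := nonempty_cosyzygy hM
  have hL := S.projective_cokernel_lift f hY h
  have hu := isSES_cokernel (biprod.lift f S.i)
  generalize cokernel.π (biprod.lift f S.i) = q at hu
  have := hu.epi
  obtain ⟨r, hr⟩ := hu.exists_lift (𝟙 _ - q ≫ Projective.factorThru (𝟙 _) q)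
    (by simp [Preadditive.sub_comp])
  have hr' : biprod.lift f S.i ≫ r = 𝟙 M := by
    rw [← cancel_mono (biprod.lift f S.i), Category.assoc, hr, Preadditive.comp_sub,
      reassoc_of% hu.zero]
    simp
  refine ⟨biprod.inl ≫ r, ⟨S.P, S.projective, S.i, biprod.inr ≫ r, ?_⟩,
    ⟨_, hL, biprod.inl ≫ q, Projective.factorThru (𝟙 _) q ≫ biprod.fst, ?_⟩⟩
  · rw [← hr', biprod.lift_eq, Preadditive.add_comp]
    simp
  · have := biprod.inl ≫= hr =≫ biprod.fst
    simp only [Category.assoc, biprod.lift_fst] at this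
    rw [Category.assoc, Category.assoc, this]
    simp [Preadditive.sub_comp]

omit [EnoughProjectives A] in
lemma IsStableIso.finitePd_cokernel (hM : gorensteinProjective A M) (h : IsStableIso f) :
    finitePd A (cokernel f) := by
  obtain ⟨S⟩ := nonempty_cosyzygy hM
  obtain ⟨g, ⟨Q, hQ, a, b, hab⟩, h₂⟩ := h
  -- The error `𝟙 M - f ≫ g` now factors through `S.i`, so it can be absorbed in the second
  -- component of an honest retraction `r` of `(f, i)`.
  obtain ⟨a, rfl⟩ := S.exists_extension Q hQ a
  rw [← S.finitePd_cokernel_lift_iff f]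
  have hu := isSES_cokernel (biprod.lift f S.i)
  generalize cokernel.π (biprod.lift f S.i) = q at hu
  have := hu.epi
  let r : Y ⊞ S.P ⟶ M := biprod.desc g (a ≫ b)
  have hr : biprod.lift f S.i ≫ r = 𝟙 M := by
    rw [Category.assoc] at hab
    simp [r, ← hab]
  have hFP : FactorsThroughProjective (𝟙 _ - r ≫ biprod.lift f S.i) := by
    -- On the summand `Y` this map is `𝟙 Y - g ≫ f` together with a map through `S.P`; the other
    -- summand is projective.
    have e : 𝟙 _ - r ≫ biprod.lift f S.i =
        biprod.fst ≫ ((𝟙 Y - g ≫ f) ≫ biprod.inl - (g ≫ S.i) ≫ biprod.inr) -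
          biprod.snd ≫ (biprod.inr ≫ (r ≫ biprod.lift f S.i - 𝟙 _)) := by
      ext <;> simp [r]
    rw [e]
    refine .sub (.precomp _ (.sub (.postcomp h₂ _) ?_)) (.precomp _ (.of_projective S.projective _))
    exact ⟨S.P, S.projective, g ≫ S.i, _, rfl⟩
  obtain ⟨s, hs⟩ := hu.exists_desc (𝟙 _ - r ≫ biprod.lift f S.i) (by
    simp [Preadditive.comp_sub, reassoc_of% hr])
  have hs' : s ≫ q = 𝟙 _ := by
    rw [← cancel_epi q, reassoc_of% hs, Preadditive.sub_comp, Category.assoc, hu.zero]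
    simp
  refine finitePd_of_projective (FactorsThroughProjective.projective ?_)
  rw [← hs', ← Category.id_comp q]
  refine FactorsThroughProjective.precomp _ ?_
  have := hFP.postcomp q
  rwa [Preadditive.sub_comp, Category.assoc, hu.zero, comp_zero, sub_zero] at this

end Mono

end StableIso

/-! ### Cofibrant objects and weak equivalences -/

section WeakEquivalences

variable {A : Type u} [Category.{v} A] [Abelian A]

lemma isZero_initial_obj : IsZero (⊥_ (GPFin A)).obj := by
  obtain ⟨Z, hZ, h⟩ := (finiteGpd A).exists_prop_of_containsZero
  have hZ' : IsInitial (⟨Z, h⟩ : GPFin A) := IsInitial.ofUniqueHom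
    (fun Y => ObjectProperty.homMk 0) (fun Y f => ObjectProperty.hom_ext _ (hZ.eq_of_src _ _))
  exact hZ.of_iso ((finiteGpd A).ι.mapIso (initialIsInitial.uniqueUpToIso hZ'))

lemma isZero_terminal_obj : IsZero (⊤_ (GPFin A)).obj := by
  obtain ⟨Z, hZ, h⟩ := (finiteGpd A).exists_prop_of_containsZero
  have hZ' : IsTerminal (⟨Z, h⟩ : GPFin A) := IsTerminal.ofUniqueHom
    (fun Y => ObjectProperty.homMk 0) (fun Y f => ObjectProperty.hom_ext _ (hZ.eq_of_tgt _ _))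
  exact hZ.of_iso ((finiteGpd A).ι.mapIso (terminalIsTerminal.uniqueUpToIso hZ'))

lemma isCofibrant_iff_gorensteinProjective (X : GPFin A) :
    IsCofibrant X ↔ gorensteinProjective A X.obj := by
  have h0 : (initial.to X).hom = 0 := isZero_initial_obj.eq_of_src _ _
  have hm : Mono (initial.to X).hom := ⟨fun _ _ _ => isZero_initial_obj.eq_of_tgt _ _⟩
  have e : cokernel (initial.to X).hom ≅ X.obj := cokernelIsoOfEq h0 ≪≫ cokernelZeroIsoTarget
  rw [isCofibrant_iff, cofibration_iff]
  exact ⟨fun h => (gorensteinProjective A).prop_of_iso e h.2,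
    fun h => ⟨hm, (gorensteinProjective A).prop_of_iso e.symm h⟩⟩

lemma isFibrant (X : GPFin A) : IsFibrant X := by
  rw [isFibrant_iff, fibration_iff]
  exact ⟨fun _ _ _ => isZero_terminal_obj.eq_of_src _ _⟩

lemma weakEquivalences_of_epi {X Y : GPFin A} (f : X ⟶ Y) [Epi f.hom]
    (h : finitePd A (kernel f.hom)) : weakEquivalences _ f :=
  have : Epi (𝟙 X.obj) := inferInstance
  ⟨X, 𝟙 X, f, by simp, inferInstanceAs (Mono (𝟙 X.obj)),
    ⟨fun _ _ _ => ⟨0, (isZero_cokernel_of_epi (𝟙 X.obj)).eq_of_src _ _⟩⟩, inferInstance, h⟩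

lemma weakEquivalences_id (X : GPFin A) : weakEquivalences _ (𝟙 X) :=
  have : IsIso (𝟙 X : X ⟶ X).hom := inferInstanceAs (IsIso (𝟙 X.obj))
  weakEquivalences_of_epi _ (finitePd_of_isZero (isZero_kernel_of_mono _))

/-- For `f = i ≫ p` there is an exact sequence `0 → ker f → ker p → coker i → 0`; in the next lemma
it is `0 → ker p → coker i → coker f → 0`. -/
lemma finitePd_kernel_of_weakEquivalences {X Y : GPFin A} (f : X ⟶ Y) [Epi f.hom]
    (h : weakEquivalences _ f) : finitePd A (kernel f.hom) := by
  obtain ⟨Z, i, p, rfl, hi, hC, hp, hK⟩ := h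
  have : Epi (i.hom ≫ p.hom) := ‹Epi (i ≫ p).hom›
  obtain ⟨j, q, h⟩ := exists_isSES_kernel_of_epi_comp i.hom p.hom
  exact h.finitePd₁ hK (finitePd_of_projective hC)

lemma finitePd_cokernel_of_weakEquivalences {X Y : GPFin A} (f : X ⟶ Y) [Mono f.hom]
    (h : weakEquivalences _ f) : finitePd A (cokernel f.hom) := by
  obtain ⟨Z, i, p, rfl, hi, hC, hp, hK⟩ := h
  have : Mono (i.hom ≫ p.hom) := ‹Mono (i ≫ p).hom›
  obtain ⟨j, q, h⟩ := exists_isSES_cokernel_of_mono_comp i.hom p.hom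
  exact h.finitePd₃ hK (finitePd_of_projective hC)

variable [EnoughProjectives A]

/-- The factorization is `X ⟶ Y ⊞ P ⟶ Y` with first map `(f, i)`: its cokernel is projective, and
the kernel of the second map is `P`. -/
lemma weakEquivalences_of_mono {X Y : GPFin A} (hX : gorensteinProjective A X.obj)
    (hY : gorensteinProjective A Y.obj) (f : X ⟶ Y) [Mono f.hom]
    (h : finitePd A (cokernel f.hom)) : weakEquivalences _ f := by
  obtain ⟨S⟩ := nonempty_cosyzygy hX
  obtain ⟨e⟩ := (isSES_biprod' Y.obj S.P).exists_kernel_iso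
  exact ⟨⟨Y.obj ⊞ S.P, finiteGpd_biprod S.projective Y.property⟩,
    ObjectProperty.homMk (biprod.lift f.hom S.i), ObjectProperty.homMk biprod.fst,
    ObjectProperty.hom_ext _ (biprod.lift_fst _ _), mono_biprod_lift _ _,
    S.projective_cokernel_lift f.hom hY h, inferInstanceAs (Epi biprod.fst),
    finitePd_of_iso e.symm (finitePd_of_projective S.projective)⟩

/-- A monomorphism with projective cokernel `C` splits, so the middle object can be taken to be `X ⊞
C`. This normal form makes composition easy. -/
lemma weakEquivalences_iff_exists_desc {X Y : GPFin A} (f : X ⟶ Y) :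
    weakEquivalences _ f ↔ ∃ (C : A) (c : C ⟶ Y.obj), Projective C ∧
      Epi (biprod.desc f.hom c) ∧ finitePd A (kernel (biprod.desc f.hom c)) := by
  constructor
  · rintro ⟨Z, i, p, rfl, hi, hC, hp, hK⟩
    have hs := isSES_cokernel i.hom
    let s := Projective.factorThru (𝟙 _) (cokernel.π i.hom)
    have hs' : s ≫ cokernel.π i.hom = 𝟙 _ := Projective.factorThru_comp _ _
    have he : biprod.desc (i ≫ p).hom (s ≫ p.hom) = biprod.desc i.hom s ≫ p.hom := by
      ext <;> simp
    have e1 : Epi (biprod.desc i.hom s) := Preadditive.epi_of_cancel_zero _ (fun t ht => by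
      have h1 : i.hom ≫ t = 0 := by simpa using biprod.inl ≫= ht
      have h2 : s ≫ t = 0 := by simpa using biprod.inr ≫= ht
      obtain ⟨l, rfl⟩ := hs.exists_desc t h1
      rw [reassoc_of% hs'] at h2
      rw [h2, comp_zero])
    have e2 : Mono (biprod.desc i.hom s) := Preadditive.mono_of_cancel_zero _ (fun k hk => by
      have h1 : k ≫ biprod.snd = 0 := by
        have := hk =≫ cokernel.π i.hom
        simpa [biprod.desc_eq, hs'] using this
      have h2 : (k ≫ biprod.fst) ≫ i.hom = 0 := by
        simpa [biprod.desc_eq, reassoc_of% h1] using hk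
      ext
      · simpa using zero_of_comp_mono _ h2
      · simpa using h1)
    refine ⟨_, s ≫ p.hom, hC, ?_, ?_⟩
    · rw [he]; infer_instance
    · rw [he]
      obtain ⟨j, q, h⟩ := exists_isSES_kernel_comp (biprod.desc i.hom s) p.hom
      exact h.finitePd₂ (finitePd_of_isZero (isZero_kernel_of_mono _)) hK
  · rintro ⟨C, c, hC, he, hK⟩
    obtain ⟨e⟩ := (isSES_biprod X.obj C).exists_cokernel_iso
    exact ⟨⟨X.obj ⊞ C, finiteGpd_biprod hC X.property⟩, ObjectProperty.homMk biprod.inl,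
      ObjectProperty.homMk (biprod.desc f.hom c), ObjectProperty.hom_ext _ (biprod.inl_desc _ _),
      inferInstanceAs (Mono biprod.inl), Projective.of_iso e.symm hC, he, hK⟩

/-- In normal form the composite is `X ⊞ C ⊞ D ⟶ Y ⊞ D ⟶ Z`, and its kernel is an extension of `ker
(g, d)` by `ker (f, c)`. -/
lemma weakEquivalences_comp {X Y Z : GPFin A} (f : X ⟶ Y) (g : Y ⟶ Z)
    (hf : weakEquivalences _ f) (hg : weakEquivalences _ g) : weakEquivalences _ (f ≫ g) := by
  rw [weakEquivalences_iff_exists_desc] at hf hg ⊢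
  obtain ⟨C, c, hC, hce, hcK⟩ := hf
  obtain ⟨D, d, hD, hde, hdK⟩ := hg
  let a : (X.obj ⊞ C) ⊞ D ⟶ Y.obj ⊞ D := biprod.map (biprod.desc f.hom c) (𝟙 D)
  let b : (X.obj ⊞ C) ⊞ D ≅ X.obj ⊞ (C ⊞ D) := biprod.associator _ _ _
  have fac : biprod.desc (f ≫ g).hom (biprod.desc (c ≫ g.hom) d) =
      b.inv ≫ a ≫ biprod.desc g.hom d := by
    rw [Iso.eq_inv_comp]
    ext <;> simp [a, b]
  have ha : IsSES (kernel.ι (biprod.desc f.hom c) ≫ (biprod.inl : _ ⟶ (X.obj ⊞ C) ⊞ D)) a :=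
    isSES_of_lift (by ext <;> simp [a]) (fun k hk => by
      obtain ⟨l, hl⟩ := (isSES_kernel (biprod.desc f.hom c)).exists_lift (k ≫ biprod.fst)
        (by simpa [a] using hk =≫ biprod.fst)
      refine ⟨l, ?_⟩
      rw [← Category.assoc, hl]
      have := hk =≫ biprod.snd
      apply biprod.hom_ext
      · simp
      · simpa [a] using this.symm)
  obtain ⟨e⟩ := ha.exists_kernel_iso
  have := ha.epi
  refine ⟨C ⊞ D, biprod.desc (c ≫ g.hom) d, inferInstance, ?_, ?_⟩
  · rw [fac]; infer_instance
  · rw [fac]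
    obtain ⟨_, _, h₁⟩ := exists_isSES_kernel_comp b.inv (a ≫ biprod.desc g.hom d)
    obtain ⟨_, _, h₂⟩ := exists_isSES_kernel_comp a (biprod.desc g.hom d)
    exact h₁.finitePd₂ (finitePd_of_isZero (isZero_kernel_of_mono _))
      (h₂.finitePd₂ (finitePd_of_iso e.symm hcK) hdK)

end WeakEquivalences

/-! ### Unit and counit; the Quillen and stable criteria -/

namespace FrobeniusPair

variable {A : Type u} [Category.{v} A] [Abelian A] {B : Type u'} [Category.{v'} B] [Abelian B]
  {F : A ⥤ B} {H : B ⥤ A} [F.Additive] [H.Additive] (e : FrobeniusPair F H)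

include e

omit [H.Additive] in
lemma map_isSES {X Y Z : A} {i : X ⟶ Y} {p : Y ⟶ Z} (h : IsSES i p) :
    IsSES (F.map i) (F.map p) :=
  have := e.adj.leftAdjoint_preservesColimits
  have := e.adj'.rightAdjoint_preservesLimits
  ⟨by rw [← F.map_comp, h.zero, F.map_zero], h.choose_spec.map_of_exact F⟩

lemma map_finitePd [EnoughProjectives A] {X : A} (hX : finitePd A X) :
    finitePd B (F.obj X) := by
  refine finitePd_induction (motive := fun X => finitePd B (F.obj X))
    (fun X h => finitePd_of_projective (e.map_projective h)) ?_ hX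
  intro K P X i p h hP _ hK
  exact (e.map_isSES h).finitePd₃ hK (finitePd_of_projective (e.map_projective hP))

lemma finitePd_kernel_map [EnoughProjectives A] {X Y : A} (f : X ⟶ Y) [Epi f]
    (h : finitePd A (kernel f)) : finitePd B (kernel (F.map f)) := by
  obtain ⟨i⟩ := (e.map_isSES (isSES_kernel f)).exists_kernel_iso
  exact finitePd_of_iso i.symm (e.map_finitePd h)

lemma map_weakEquivalences [EnoughProjectives A] {X Y : GPFin A} (f : X ⟶ Y)
    (h : weakEquivalences _ f) : weakEquivalences _ (e.onGPFin.map f) := by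
  obtain ⟨Z, i, p, rfl, hi, hC, hp, hK⟩ := h
  have hi' := e.map_isSES (isSES_cokernel i.hom)
  obtain ⟨c⟩ := hi'.exists_cokernel_iso
  exact ⟨e.onGPFin.obj Z, e.onGPFin.map i, e.onGPFin.map p, (e.onGPFin.map_comp i p).symm,
    hi'.mono, Projective.of_iso c.symm (e.map_projective hC), (e.map_isSES (isSES_kernel p.hom)).epi,
    e.finitePd_kernel_map p.hom hK⟩

lemma map_cofibrations {X Y : GPFin A} (f : X ⟶ Y)
    (h : cofibrations _ f) : cofibrations _ (e.onGPFin.map f) := by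
  obtain ⟨hi, hC⟩ := h
  have hi' := e.map_isSES (isSES_cokernel f.hom)
  obtain ⟨c⟩ := hi'.exists_cokernel_iso
  exact ⟨hi'.mono, (gorensteinProjective B).prop_of_iso c.symm (e.map_gorensteinProjective hC)⟩

lemma isQuillenAdjunction [EnoughProjectives A] : IsQuillenAdjunction e.adjOnGPFin :=
  ⟨fun _ _ => e.map_cofibrations,
    fun _ _ f h => ⟨e.map_cofibrations f h.1, e.map_weakEquivalences f h.2⟩⟩

lemma adjOnGPFin_unit_app (X : GPFin A) :
    (e.adjOnGPFin.unit.app X).hom = e.adj.unit.app X.obj := by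
  have := Adjunction.map_restrictFullyFaithful_unit_app e.adj (finiteGpd A).fullyFaithfulι
    (finiteGpd B).fullyFaithfulι (L := e.onGPFin) (R := e.symm.onGPFin) (Iso.refl _) (Iso.refl _) X
  refine this.trans ?_
  change e.adj.unit.app X.obj ≫ H.map (𝟙 (F.obj X.obj)) ≫ 𝟙 (H.obj (F.obj X.obj)) = _
  rw [H.map_id, Category.comp_id]
  exact Category.comp_id _

lemma adjOnGPFin_counit_app (Y : GPFin B) :
    (e.adjOnGPFin.counit.app Y).hom = e.adj.counit.app Y.obj := by
  have := Adjunction.map_restrictFullyFaithful_counit_app e.adj (finiteGpd A).fullyFaithfulι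
    (finiteGpd B).fullyFaithfulι (L := e.onGPFin) (R := e.symm.onGPFin) (Iso.refl _) (Iso.refl _) Y
  refine this.trans ?_
  change 𝟙 (F.obj (H.obj Y.obj)) ≫ F.map (𝟙 (H.obj Y.obj)) ≫ e.adj.counit.app Y.obj = _
  rw [F.map_id, Category.id_comp, Category.id_comp]

/-- A left adjoint is faithful exactly when the unit is mono; dually for the counit in the next
lemma. -/
lemma mono_adjOnGPFin_unit_app [F.Faithful] (X : GPFin A) :
    Mono (e.adjOnGPFin.unit.app X).hom := by
  have h : Mono (e.adj.unit.app X.obj) := inferInstance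
  rw [← adjOnGPFin_unit_app] at h
  exact h

lemma epi_adjOnGPFin_counit_app [H.Faithful] (Y : GPFin B) :
    Epi (e.adjOnGPFin.counit.app Y).hom := by
  have h : Epi (e.adj.counit.app Y.obj) := inferInstance
  rw [← adjOnGPFin_counit_app] at h
  exact h

lemma adjOnGP_unit_app (X : GP A) :
    (e.adjOnGP.unit.app X).hom = e.adj.unit.app X.obj := by
  have := Adjunction.map_restrictFullyFaithful_unit_app e.adj
    (gorensteinProjective A).fullyFaithfulι (gorensteinProjective B).fullyFaithfulι
    (L := e.onGP) (R := e.symm.onGP) (Iso.refl _) (Iso.refl _) X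
  refine this.trans ?_
  change e.adj.unit.app X.obj ≫ H.map (𝟙 (F.obj X.obj)) ≫ 𝟙 (H.obj (F.obj X.obj)) = _
  rw [H.map_id, Category.comp_id]
  exact Category.comp_id _

lemma adjOnGP_counit_app (Y : GP B) :
    (e.adjOnGP.counit.app Y).hom = e.adj.counit.app Y.obj := by
  have := Adjunction.map_restrictFullyFaithful_counit_app e.adj
    (gorensteinProjective A).fullyFaithfulι (gorensteinProjective B).fullyFaithfulι
    (L := e.onGP) (R := e.symm.onGP) (Iso.refl _) (Iso.refl _) Y
  refine this.trans ?_
  change 𝟙 (F.obj (H.obj Y.obj)) ≫ F.map (𝟙 (H.obj Y.obj)) ≫ e.adj.counit.app Y.obj = _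
  rw [F.map_id, Category.id_comp, Category.id_comp]

lemma isIso_adjOnStable_unit_iff : IsIso e.adjOnStable.unit ↔
    ∀ X : GP A, IsStableIso (e.adj.unit.app X.obj) := by
  rw [NatTrans.isIso_iff_isIso_app]
  refine ⟨fun h X => ?_, fun h X => ?_⟩
  · rw [← e.adjOnGP_unit_app]
    exact (isIso_toStable_map_iff (e.adjOnGP.unit.app X)).1 (h ((toStable A).obj X))
  · have := h X.as
    rw [← e.adjOnGP_unit_app] at this
    exact (isIso_toStable_map_iff (e.adjOnGP.unit.app _)).2 this

lemma isIso_adjOnStable_counit_iff : IsIso e.adjOnStable.counit ↔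
    ∀ Y : GP B, IsStableIso (e.adj.counit.app Y.obj) := by
  rw [NatTrans.isIso_iff_isIso_app]
  refine ⟨fun h Y => ?_, fun h Y => ?_⟩
  · rw [← e.adjOnGP_counit_app]
    exact (isIso_toStable_map_iff (e.adjOnGP.counit.app Y)).1 (h ((toStable B).obj Y))
  · have := h Y.as
    rw [← e.adjOnGP_counit_app] at this
    exact (isIso_toStable_map_iff (e.adjOnGP.counit.app _)).2 this

/-- If the kernel of the counit has finite projective dimension on Gorenstein projective objects,
so it has on the objects of finite Gorenstein projective dimension. -/
lemma finitePd_kernel_counit [H.Faithful]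
    (h : ∀ G : B, gorensteinProjective B G → finitePd B (kernel (e.adj.counit.app G))) (n : ℕ) :
    ∀ {Y : B}, gpdLE B n Y → finitePd B (kernel (e.adj.counit.app Y)) := by
  induction n with
  | zero => exact fun hY => h _ hY
  | succ n ih =>
    rintro Y ⟨K, G, i, p, w, hs, hG, hK⟩
    have hs : IsSES i p := ⟨w, hs⟩
    -- Naturality makes `ε` a morphism of short exact sequences with epi components, so its kernels
    -- form a short exact sequence.
    obtain ⟨j, q, hjq⟩ := exists_isSES_kernel (e.map_isSES (e.symm.map_isSES hs)) hs
      (e.adj.counit.app K) (e.adj.counit.app G) (e.adj.counit.app Y)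
      (e.adj.counit.naturality i) (e.adj.counit.naturality p)
    exact hjq.finitePd₃ (ih hK) (h G hG)

variable [EnoughProjectives A] [EnoughProjectives B] [F.Faithful] [H.Faithful]

lemma finitePd_iff_stableIso :
    (∀ (X : A) (Y : B), gorensteinProjective A X → finiteGpd B Y →
      finitePd A (cokernel (e.adj.unit.app X)) ∧ finitePd B (kernel (e.adj.counit.app Y))) ↔
    (∀ X : GP A, IsStableIso (e.adj.unit.app X.obj)) ∧
      ∀ Y : GP B, IsStableIso (e.adj.counit.app Y.obj) := by
  constructor
  · refine fun h => ⟨fun X => ?_, fun Y => ?_⟩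
    -- Condition 2 quantifies over `X` and `Y` jointly; the zero object fills the idle variable here
    -- and below.
    · exact isStableIso_of_finitePd_cokernel _ X.property
        (e.symm.map_gorensteinProjective (e.map_gorensteinProjective X.property))
        (h X.obj 0 X.property ⟨0, gorensteinProjective_of_projective inferInstance⟩).1
    · exact isStableIso_of_finitePd_kernel
        (e.map_gorensteinProjective (e.symm.map_gorensteinProjective Y.property)) Y.property _
        (h 0 Y.obj (gorensteinProjective_of_projective inferInstance) ⟨0, Y.property⟩).2
  · rintro ⟨h₁, h₂⟩ X Y hX ⟨n, hY⟩
    exact ⟨(h₁ ⟨X, hX⟩).finitePd_cokernel _ hX, e.finitePd_kernel_counit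
      (fun G hG => finitePd_of_projective (h₂ ⟨G, hG⟩).projective_kernel) n hY⟩

lemma isQuillenEquivalence_iff :
    IsQuillenEquivalence e.adjOnGPFin ↔
    ∀ (X : A) (Y : B), gorensteinProjective A X → finiteGpd B Y →
      finitePd A (cokernel (e.adj.unit.app X)) ∧ finitePd B (kernel (e.adj.counit.app Y)) := by
  constructor
  · intro h X Y hX hY
    constructor
    · let X' : GPFin A := ⟨X, 0, hX⟩
      have h₁ := (h.weakEquivalences_iff X' (e.onGPFin.obj X')
        ((isCofibrant_iff_gorensteinProjective X').2 hX) (isFibrant _) (𝟙 _)).1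
        (weakEquivalences_id _)
      rw [Adjunction.homEquiv_id] at h₁
      have hη := e.adjOnGPFin_unit_app X'
      have := e.mono_adjOnGPFin_unit_app X'
      have := finitePd_cokernel_of_weakEquivalences _ h₁
      rwa [hη] at this
    · obtain ⟨n, hY⟩ := hY
      -- The criterion applies to `ε` at `G` only when `H G` is cofibrant, so it is tested on
      -- Gorenstein projective `G`.
      refine e.finitePd_kernel_counit (fun G hG => ?_) n hY
      let G' : GPFin B := ⟨G, 0, hG⟩
      have h₁ := (h.weakEquivalences_iff (e.symm.onGPFin.obj G') G'
        ((isCofibrant_iff_gorensteinProjective _).2 (e.symm.map_gorensteinProjective hG))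
        (isFibrant _) (e.adjOnGPFin.counit.app G')).2 (by
          rw [← e.adjOnGPFin.homEquiv_symm_id, Equiv.apply_symm_apply]
          exact weakEquivalences_id _)
      have hε := e.adjOnGPFin_counit_app G'
      have := e.epi_adjOnGPFin_counit_app G'
      have := finitePd_kernel_of_weakEquivalences _ h₁
      rwa [hε] at this
  · refine fun h => { toIsQuillenAdjunction := e.isQuillenAdjunction, weakEquivalences_iff := ?_ }
    intro X Y hX _ f
    rw [isCofibrant_iff_gorensteinProjective] at hX
    obtain ⟨hη, hε⟩ := h X.obj Y.obj hX Y.property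
    rw [← e.adjOnGPFin_unit_app] at hη
    rw [← e.adjOnGPFin_counit_app] at hε
    have := e.mono_adjOnGPFin_unit_app X
    have := e.epi_adjOnGPFin_counit_app Y
    constructor
    · intro hf
      rw [Adjunction.homEquiv_unit]
      exact weakEquivalences_comp _ _ (weakEquivalences_of_mono hX
        (e.symm.map_gorensteinProjective (e.map_gorensteinProjective hX)) _ hη)
        (e.symm.map_weakEquivalences f hf)
    · intro hf
      have := weakEquivalences_comp _ _ (e.map_weakEquivalences _ hf)
        (weakEquivalences_of_epi _ hε)
      have key : e.onGPFin.map (e.adjOnGPFin.homEquiv X Y f) ≫ e.adjOnGPFin.counit.app Y = f :=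
        (Adjunction.homEquiv_counit ..).symm.trans (Equiv.symm_apply_apply _ f)
      rwa [key] at this

end FrobeniusPair

/-! ### Independence of triangles from the chosen cosyzygy -/

section RelativeSuspension

variable {A : Type u} [Category.{v} A] [Abelian A]

namespace Cosyzygy

/-- The morphism `h` between cosyzygies is induced by `f`. -/
def Induces {M M' : A} (S : Cosyzygy M) (S' : Cosyzygy M') (f : M ⟶ M') (h : S.N ⟶ S'.N) : Prop :=
  ∃ g : S.P ⟶ S'.P, S.i ≫ g = f ≫ S'.i ∧ S.p ≫ h = g ≫ S'.p

lemma exists_induces {M M' : A} (S : Cosyzygy M) (S' : Cosyzygy M') (f : M ⟶ M') :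
    ∃ h, S.Induces S' f h := by
  obtain ⟨g, hg⟩ := S.exists_extension _ S'.projective (f ≫ S'.i)
  obtain ⟨h, hh⟩ := S.exists_desc (g ≫ S'.p) (by
    rw [← Category.assoc, hg, Category.assoc, S'.w, comp_zero])
  exact ⟨h, g, hg, hh⟩

lemma Induces.comp {M M' M'' : A} {S : Cosyzygy M} {S' : Cosyzygy M'} {S'' : Cosyzygy M''}
    {f : M ⟶ M'} {f' : M' ⟶ M''} {h : S.N ⟶ S'.N} {h' : S'.N ⟶ S''.N} (H : S.Induces S' f h)
    (H' : S'.Induces S'' f' h') : S.Induces S'' (f ≫ f') (h ≫ h') := by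
  obtain ⟨g, hg, hp⟩ := H
  obtain ⟨g', hg', hp'⟩ := H'
  exact ⟨g ≫ g', by rw [reassoc_of% hg, hg', Category.assoc],
    by rw [reassoc_of% hp, hp', Category.assoc]⟩

lemma induces_id {M : A} (S : Cosyzygy M) : S.Induces S (𝟙 M) (𝟙 S.N) :=
  ⟨𝟙 _, by simp, by simp⟩

/-- Two fillings `g`, `g'` agree on `M`, so `g - g'` descends to `S.N ⟶ S'.P`, through which `h -
h'` factors. This uniqueness yields the later stable identities. -/
lemma Induces.factorsThroughProjective_sub {M M' : A} {S : Cosyzygy M} {S' : Cosyzygy M'}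
    {f : M ⟶ M'} {h h' : S.N ⟶ S'.N} (H : S.Induces S' f h) (H' : S.Induces S' f h') :
    FactorsThroughProjective (h - h') := by
  obtain ⟨g, hg, hp⟩ := H
  obtain ⟨g', hg', hp'⟩ := H'
  obtain ⟨k, hk⟩ := S.exists_desc (g - g') (by rw [Preadditive.comp_sub, hg, hg', sub_self])
  refine ⟨_, S'.projective, k, S'.p, ?_⟩
  have : Epi S.p := S.shortExact.epi_g
  rw [← cancel_epi S.p, reassoc_of% hk, Preadditive.comp_sub, hp, hp', Preadditive.sub_comp]

end Cosyzygy

/-- `L` is a pushout of `f` along `M ⟶ P` for a cosyzygy `0 ⟶ M ⟶ P ⟶ N' ⟶ 0`, and `h` is the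
induced map `L ⟶ N'`. -/
structure IsTriangleOver {M N L : A} (S : Cosyzygy M) (f : M ⟶ N) (g : N ⟶ L) (p : S.P ⟶ L)
    (h : L ⟶ S.N) : Prop where
  isPushout : IsPushout f S.i g p
  zero : g ≫ h = 0
  fac : p ≫ h = S.p

namespace IsTriangleOver

variable {M N L L' : A} {S S' : Cosyzygy M} {f : M ⟶ N} {g : N ⟶ L} {p : S.P ⟶ L} {h : L ⟶ S.N}
  {g' : N ⟶ L'} {p' : S'.P ⟶ L'} {h' : L' ⟶ S'.N}

lemma isSES (T : IsTriangleOver S f g p h) : IsSES g h := by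
  have := S.isSES.epi
  have hg : Mono g := (MorphismProperty.monomorphisms A).of_isPushout T.isPushout S.isSES.mono
  have hh : Epi h := by
    have : Epi (p ≫ h) := by rwa [T.fac]
    exact epi_of_epi p h
  refine isSES_of_desc T.zero (fun k hk => ?_)
  obtain ⟨l, hl⟩ := S.exists_desc (p ≫ k) (by rw [← T.isPushout.w_assoc, hk, comp_zero])
  refine ⟨l, T.isPushout.hom_ext ?_ ?_⟩
  · rw [reassoc_of% T.zero, zero_comp, hk]
  · rw [reassoc_of% T.fac, hl]

/-- Comparison of two triangles over different cosyzygies: the round trip is the identity up to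
a morphism which factors through a projective object. -/
lemma factorsThroughProjective_sub (T : IsTriangleOver S f g p h) {α : S.P ⟶ S'.P}
    {α' : S'.P ⟶ S.P} (hα : S.i ≫ α = S'.i) (hα' : S'.i ≫ α' = S.i)
    {κ : L ⟶ L'} {κ' : L' ⟶ L} (h₁ : g ≫ κ = g') (h₂ : p ≫ κ = α ≫ p')
    (h₁' : g' ≫ κ' = g) (h₂' : p' ≫ κ' = α' ≫ p) :
    FactorsThroughProjective (𝟙 L - κ ≫ κ') := by
  -- The claim is `𝟙 L - κ ≫ κ' = h ≫ t ≫ p`, checked on the two legs of the pushout.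
  obtain ⟨t, ht⟩ := S.exists_desc (𝟙 _ - α ≫ α') (by
    rw [Preadditive.comp_sub, reassoc_of% hα, hα', Category.comp_id, sub_self])
  refine ⟨S.P, S.projective, h ≫ t, p, T.isPushout.hom_ext ?_ ?_⟩
  · simp [Preadditive.comp_sub, reassoc_of% h₁, h₁', reassoc_of% T.zero]
  · simp [Preadditive.comp_sub, Preadditive.sub_comp, reassoc_of% h₂, h₂', reassoc_of% T.fac,
      reassoc_of% ht]

/-- Extending `𝟙 M` to maps between the two projectives, in both directions, induces mutually stably
inverse maps of the pushouts. -/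
lemma exists_isStableIso (T : IsTriangleOver S f g p h) (T' : IsTriangleOver S' f g' p' h')
    {β : S'.N ⟶ S.N} (hβ : S'.Induces S (𝟙 M) β) :
    ∃ κ : L ⟶ L', IsStableIso κ ∧ g ≫ κ = g' ∧ FactorsThroughProjective (h - κ ≫ h' ≫ β) := by
  obtain ⟨α', hα', hβ⟩ := hβ
  rw [Category.id_comp] at hα'
  obtain ⟨α, hα⟩ := S.exists_extension _ S'.projective S'.i
  let κ : L ⟶ L' := T.isPushout.desc g' (α ≫ p') (by
    rw [T'.isPushout.w, reassoc_of% hα])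
  let κ' : L' ⟶ L := T'.isPushout.desc g (α' ≫ p) (by
    rw [T.isPushout.w, reassoc_of% hα'])
  have h₁ : g ≫ κ = g' := T.isPushout.inl_desc _ _ _
  have h₂ : p ≫ κ = α ≫ p' := T.isPushout.inr_desc _ _ _
  have h₁' : g' ≫ κ' = g := T'.isPushout.inl_desc _ _ _
  have h₂' : p' ≫ κ' = α' ≫ p := T'.isPushout.inr_desc _ _ _
  refine ⟨κ, ⟨κ', T.factorsThroughProjective_sub hα hα' h₁ h₂ h₁' h₂',
    T'.factorsThroughProjective_sub hα' hα h₁' h₂' h₁ h₂⟩, h₁, ?_⟩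
  obtain ⟨t, ht⟩ := S.exists_desc (𝟙 _ - α ≫ α') (by
    rw [Preadditive.comp_sub, reassoc_of% hα, hα', Category.comp_id, sub_self])
  refine ⟨S.P, S.projective, h ≫ t, S.p, T.isPushout.hom_ext ?_ ?_⟩
  · simp [Preadditive.comp_sub, reassoc_of% h₁, reassoc_of% T.zero, T.zero, reassoc_of% T'.zero]
  · simp [Preadditive.comp_sub, Preadditive.sub_comp, reassoc_of% h₂, T.fac, reassoc_of% T.fac,
      reassoc_of% ht, reassoc_of% T'.fac, hβ]

end IsTriangleOver

/-- Up to isomorphism in the stable category, a triangle over any cosyzygy is standard. -/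
lemma IsTriangleOver.exists_standard [EnoughProjectives A] {M N L : GP A} {S : Cosyzygy M.obj}
    {f : M ⟶ N} {g : N ⟶ L} {p : S.P ⟶ L.obj} {h : L.obj ⟶ S.N}
    (T : IsTriangleOver S f.hom g.hom p h) {β : S.N ⟶ (cosyzygy M).N}
    (hβ : S.Induces (cosyzygy M) (𝟙 _) β) :
    ∃ (L' : GP A) (g' : N ⟶ L') (h' : L' ⟶ suspensionObj M)
      (κ : (toStable A).obj L' ≅ (toStable A).obj L), IsStandardTriangle f g' h' ∧
        (toStable A).map g' ≫ κ.hom = (toStable A).map g ∧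
        (toStable A).map h' = κ.hom ≫ (toStable A).map
          (show L ⟶ suspensionObj M from ObjectProperty.homMk (h ≫ β)) := by
  have T' : IsTriangleOver (cosyzygy M) f.hom (pushout.inl f.hom (cosyzygy M).i)
      (pushout.inr f.hom (cosyzygy M).i)
      (pushout.desc 0 (cosyzygy M).p (by simp [(cosyzygy M).w])) :=
    ⟨IsPushout.of_hasPushout _ _, pushout.inl_desc _ _ _, pushout.inr_desc _ _ _⟩
  obtain ⟨κ, hκ, h₁, h₂⟩ := T'.exists_isStableIso T hβ
  let L' : GP A := ⟨_, gorensteinProjective_of_isSES T'.isSES N.property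
    (cosyzygy M).gorensteinProjective⟩
  let κ' : L' ⟶ L := ObjectProperty.homMk κ
  have : IsIso ((toStable A).map κ') := (isIso_toStable_map_iff κ').2 hκ
  refine ⟨L', ObjectProperty.homMk (pushout.inl _ _), ObjectProperty.homMk (pushout.desc 0 _ _),
    asIso ((toStable A).map κ'), ⟨_, T'.isPushout, ObjectProperty.hom_ext _ T'.zero, T'.fac⟩, ?_, ?_⟩
  · rw [asIso_hom, ← Functor.map_comp]
    exact congrArg _ (ObjectProperty.hom_ext _ h₁)
  · rw [asIso_hom, ← Functor.map_comp]
    exact toStable_map_eq h₂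

/-- Frees `suspension` from its arbitrary choice of a representative on morphisms. -/
lemma suspension_map_eq {M M' : GP A} (f : M ⟶ M') {h : suspensionObj M ⟶ suspensionObj M'}
    (H : (cosyzygy M).Induces (cosyzygy M') f.hom h.hom) :
    (suspension A).map ((toStable A).map f) = (toStable A).map h :=
  toStable_map_eq (Cosyzygy.Induces.factorsThroughProjective_sub
    (exists_isSuspension f).choose_spec H)

lemma comp_eq_of_fac {C : Type*} [Category C] {N L L' Y Z : C} {g' : N ⟶ L'} {κ : L' ⟶ L}
    {g : N ⟶ L} {b : N ⟶ Y} {c : L ⟶ Z} {y : Y ⟶ Z} (h : g' ≫ κ = g) (h' : g ≫ c = b ≫ y) :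
    g' ≫ κ ≫ c = b ≫ y := by
  rw [reassoc_of% h, h']

lemma comp_eq_of_fac' {C : Type*} [Category C] {L L' Z M M' X X' : C} {h' : L' ⟶ M'}
    {κ : L' ⟶ L} {h : L ⟶ M} {φ : M ⟶ M'} {a : M ⟶ X} {a' : M' ⟶ X'} {c : L ⟶ Z} {z : Z ⟶ X}
    {ψ : X ⟶ X'} (H : h' = κ ≫ h ≫ φ) (H' : h ≫ a = c ≫ z) (H'' : a ≫ ψ = φ ≫ a') :
    h' ≫ a' = (κ ≫ c) ≫ z ≫ ψ := by
  rw [H, Category.assoc, Category.assoc, ← H'', reassoc_of% H', Category.assoc]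

end RelativeSuspension

/-! ### The induced stable functors are triangle functors -/

namespace FrobeniusPair

variable {A : Type u} [Category.{v} A] [Abelian A] {B : Type u'} [Category.{v'} B] [Abelian B]
  {F : A ⥤ B} {H : B ⥤ A} [F.Additive] [H.Additive] (e : FrobeniusPair F H)

include e

/-- The image of a cosyzygy. -/
def mapCosyzygy {M : A} (S : Cosyzygy M) : Cosyzygy (F.obj M) where
  P := F.obj S.P
  N := F.obj S.N
  i := F.map S.i
  p := F.map S.p
  w := (e.map_isSES S.isSES).zero
  shortExact := (e.map_isSES S.isSES).choose_spec
  projective := e.map_projective S.projective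
  gorensteinProjective := e.map_gorensteinProjective S.gorensteinProjective
  exists_extension Q hQ f := by
    -- By adjunction, extending `F M ⟶ Q` amounts to extending `M ⟶ H Q`, with `H Q` projective.
    obtain ⟨g, hg⟩ := S.exists_extension (H.obj Q) (e.symm.map_projective hQ) (e.adj.homEquiv _ _ f)
    refine ⟨(e.adj.homEquiv _ _).symm g, ?_⟩
    rw [← e.adj.homEquiv_naturality_left_symm, hg, Equiv.symm_apply_apply]

lemma map_induces {M M' : A} {S : Cosyzygy M} {S' : Cosyzygy M'} {f : M ⟶ M'} {h : S.N ⟶ S'.N}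
    (hfh : S.Induces S' f h) :
    (e.mapCosyzygy S).Induces (e.mapCosyzygy S') (F.map f) (F.map h) := by
  obtain ⟨g, hg, hp⟩ := hfh
  refine ⟨F.map g, ?_, ?_⟩
  · exact (F.map_comp _ _).symm.trans ((congrArg F.map hg).trans (F.map_comp _ _))
  · exact (F.map_comp _ _).symm.trans ((congrArg F.map hp).trans (F.map_comp _ _))

lemma map_isTriangleOver {M N L : A} {S : Cosyzygy M} {f : M ⟶ N} {g : N ⟶ L} {p : S.P ⟶ L}
    {h : L ⟶ S.N} (T : IsTriangleOver S f g p h) :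
    IsTriangleOver (e.mapCosyzygy S) (F.map f) (F.map g) (F.map p) (F.map h) where
  isPushout :=
    have := e.adj.leftAdjoint_preservesColimits
    T.isPushout.map F
  zero := (F.map_comp _ _).symm.trans ((congrArg F.map T.zero).trans (F.map_zero _ _))
  fac := (F.map_comp _ _).symm.trans (congrArg F.map T.fac)

/-- The image of the chosen cosyzygy of a Gorenstein projective object. -/
noncomputable def imageCosyzygy (M : GP A) : Cosyzygy (e.onGP.obj M).obj :=
  e.mapCosyzygy (cosyzygy M)

lemma exists_comparison (M : GP A) :
    ∃ β : e.onGP.obj (suspensionObj M) ⟶ suspensionObj (e.onGP.obj M),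
    (e.imageCosyzygy M).Induces (cosyzygy (e.onGP.obj M)) (𝟙 _) β.hom :=
  ⟨ObjectProperty.homMk _, (Cosyzygy.exists_induces _ _ _).choose_spec⟩

/-- The morphism `F(ΣM) ⟶ Σ(FM)` induced by the identity of `FM`. -/
noncomputable def comparison (M : GP A) :
    e.onGP.obj (suspensionObj M) ⟶ suspensionObj (e.onGP.obj M) :=
  (e.exists_comparison M).choose

lemma induces_comparison (M : GP A) :
    (e.imageCosyzygy M).Induces (cosyzygy (e.onGP.obj M)) (𝟙 _) (e.comparison M).hom :=
  (e.exists_comparison M).choose_spec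

/-- The comparison in the other direction is a stable inverse: the composites and the identities are
both induced by `𝟙`, hence stably equal. -/
lemma isStableIso_comparison (M : GP A) : IsStableIso (e.comparison M).hom := by
  have h := e.induces_comparison M
  obtain ⟨β, hβ⟩ := (cosyzygy (e.onGP.obj M)).exists_induces (e.imageCosyzygy M) (𝟙 _)
  refine ⟨β, ?_, ?_⟩
  · have := h.comp hβ
    rw [Category.id_comp] at this
    exact (Cosyzygy.induces_id _).factorsThroughProjective_sub this
  · have := hβ.comp h
    rw [Category.id_comp] at this
    exact (Cosyzygy.induces_id _).factorsThroughProjective_sub this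

instance isIso_comparison (M : GP A) : IsIso ((toStable B).map (e.comparison M)) :=
  (isIso_toStable_map_iff _).2 (e.isStableIso_comparison M)

/-- Both composites are induced by `F f` from the image cosyzygy of `M` to the chosen one of `F M'`.
-/
lemma comparison_naturality {M M' : GP A} (f : M ⟶ M') :
    e.onStable.map ((suspension A).map ((toStable A).map f)) ≫
      (toStable B).map (e.comparison M') =
    (toStable B).map (e.comparison M) ≫
      (suspension B).map (e.onStable.map ((toStable A).map f)) := by
  obtain ⟨h, hh⟩ := exists_isSuspension f
  obtain ⟨k, hk⟩ := exists_isSuspension (e.onGP.map f)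
  rw [suspension_map_eq f hh]
  refine Eq.trans ?_ (congrArg _ (suspension_map_eq (e.onGP.map f) hk).symm)
  have hF : (e.imageCosyzygy M).Induces (e.imageCosyzygy M') (e.onGP.map f).hom
    (e.onGP.map h).hom := e.map_induces hh
  have h₁ := hF.comp (e.induces_comparison M')
  have h₂ := (e.induces_comparison M).comp hk
  rw [Category.comp_id] at h₁
  rw [Category.id_comp] at h₂
  refine ((toStable B).map_comp (e.onGP.map h) (e.comparison M')).symm.trans
    (Eq.trans ?_ ((toStable B).map_comp (e.comparison M) k))
  exact toStable_map_eq (h₁.factorsThroughProjective_sub h₂)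

/-- The functor induced by `F` on stable categories commutes with the suspensions. -/
noncomputable def suspensionIso : suspension A ⋙ e.onStable ≅ e.onStable ⋙ suspension B :=
  NatIso.ofComponents (fun X => @asIso _ _ _ _ _ (e.isIso_comparison X.as)) (fun {X Y} f => by
    obtain ⟨f, rfl⟩ := (toStable A).map_surjective f
    exact e.comparison_naturality f)

lemma onStable_additive : e.onStable.Additive where
  map_add {X Y f g} := by
    obtain ⟨f, rfl⟩ := (toStable A).map_surjective f
    obtain ⟨g, rfl⟩ := (toStable A).map_surjective g
    exact congrArg (toStable B).map (ObjectProperty.hom_ext _ (F.map_add (f := f.hom) (g := g.hom)))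

/-- `F` sends a standard triangle to a triangle over the image cosyzygy, and `exists_standard`
replaces this by a standard one at the cost of the comparison `F(ΣM) ⟶ Σ(FM)`. -/
lemma isTriangleFunctor_onStable [EnoughProjectives B] : IsTriangleFunctor e.onStable := by
  refine ⟨e.onStable_additive, e.suspensionIso, ?_⟩
  rintro X Y Z x y z ⟨M, N, L, f, g, h, ⟨p, hp, hgh, hph⟩, a, b, c, h₁, h₂, h₃⟩
  have T : IsTriangleOver (cosyzygy M) f.hom g.hom p h.hom :=
    ⟨hp, congrArg InducedCategory.Hom.hom hgh, hph⟩
  have T' : IsTriangleOver (e.imageCosyzygy M) (e.onGP.map f).hom (e.onGP.map g).hom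
    (F.map p) (F.map h.hom) := e.map_isTriangleOver T
  obtain ⟨L', g', h', κ, hT, hg', hh'⟩ := T'.exists_standard (e.induces_comparison M)
  refine ⟨e.onGP.obj M, e.onGP.obj N, L', e.onGP.map f, g', h', hT, e.onStable.mapIso a,
    e.onStable.mapIso b, κ ≪≫ e.onStable.mapIso c, ?_, ?_, ?_⟩
  · have := congrArg e.onStable.map h₁
    rw [Functor.map_comp, Functor.map_comp] at this
    exact this
  · have := congrArg e.onStable.map h₂
    rw [Functor.map_comp, Functor.map_comp] at this
    exact comp_eq_of_fac hg' this
  · have h₃' := congrArg e.onStable.map h₃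
    rw [Functor.map_comp, Functor.map_comp] at h₃'
    have hn := e.suspensionIso.hom.naturality a.hom
    have hc : (toStable B).map (show e.onGP.obj L ⟶ suspensionObj (e.onGP.obj M) from
        ObjectProperty.homMk (F.map h.hom ≫ (e.comparison M).hom)) =
        e.onStable.map ((toStable A).map h) ≫ e.suspensionIso.hom.app ((toStable A).obj M) :=
      (toStable B).map_comp (e.onGP.map h) (e.comparison M)
    exact comp_eq_of_fac' (hh'.trans (congrArg _ hc)) h₃' hn

end FrobeniusPair

end GorensteinStable

theorem mainTheorem1 {A : Type u} [Category.{v} A] [Abelian A] [EnoughProjectives A]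
    {B : Type u'} [Category.{v'} B] [Abelian B] [EnoughProjectives B]
    (F : A ⥤ B) (H : B ⥤ A) [F.Additive] [H.Additive] [F.Faithful] [H.Faithful]
    (e : GorensteinStable.FrobeniusPair F H) :
    List.TFAE [
      GorensteinStable.IsQuillenEquivalence e.adjOnGPFin,
      ∀ (X : A) (Y : B), GorensteinStable.gorensteinProjective A X →
        GorensteinStable.finiteGpd B Y →
          GorensteinStable.finitePd A (cokernel (e.adj.unit.app X)) ∧
          GorensteinStable.finitePd B (kernel (e.adj.counit.app Y)),
      e.InducesStableTriangleEquivalence] := by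
  tfae_have 1 ↔ 2 := e.isQuillenEquivalence_iff
  tfae_have 2 ↔ 3 := by
    rw [e.finitePd_iff_stableIso, ← e.isIso_adjOnStable_unit_iff,
      ← e.isIso_adjOnStable_counit_iff]
    exact ⟨fun h => ⟨e.isTriangleFunctor_onStable, e.symm.isTriangleFunctor_onStable, h.1, h.2⟩,
      fun h => ⟨h.isIso_unit, h.isIso_counit⟩⟩
  tfae_finish
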